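/- Let $k$ be a field and let $A$ be a separable $k$-algebra, i.e. an associative unital $k$-algebra that is projective as an $A$-$A$-bimodule (a module over $A\otimes_k A^{\mathrm{op}}$). For a unital $k$-algebra $R$, let $C(R)$ be its mixed complex, with $R^{\otimes_k (n+1)}$ in degree $n\ge 0$, Hochschild boundary $b$ and Connes operator $B=(1-t)sN$. Let $HH(R)$ be the Hochschild complex $(C(R),b)$; let $HC(R)$ be the cyclic complex, with $\bigoplus_{i\ge 0} C(R)_{n-2i}$ in degree $n$; let $HN(R)$ be the negative cyclic complex, with $\prod_{i\ge 0} C(R)_{n+2i}$ in degree $n\in\mathbb{Z}$; and let $HP(R)$ be the $\mathbb{Z}/2$-graded periodic cyclic complex, with $\prod_{m\equiv p \bmod 2} C(R)_m$ in degree $p$; the last three carry the differential $b+B$. Write $HH_j, HC_j, HP_j, HN_j$ for their homology in degree $j\in\mathbb{Z}$ (for $HP$: in degree $j \bmod 2$). Let $\mathcal{D}(\Lambda)$, $\mathcal{D}(k)$ and $\mathcal{D}_{\mathbb{Z}/2}(k)$ be the derived categories (localizations at the quasi-isomorphisms) of $\mathbb{Z}$-graded mixed complexes, of $\mathbb{Z}$-graded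 complexes and of $\mathbb{Z}/2$-graded complexes of $k$-vector spaces. Then there are isomorphisms $$C(A)\simeq C(k)\otimes HH_0(A)\quad\text{in } \mathcal{D}(\Lambda),$$ $$HH(A)\simeq HH(k)\otimes HH_0(A),\qquad HC(A)\simeq HC(k)\otimes HH_0(A),\qquad HN(A)\simeq HN(k)\otimes HH_0(A)\quad\text{in }\mathcal{D}(k),$$ $$HP(A)\simeq HP(k)\otimes HH_0(A)\quad\text{in }\mathcal{D}_{\mathbb{Z}/2}(k),$$ where $\otimes=\otimes_k$. Moreover, with $[A,A]$ the $k$-linear span of the commutators $ab-ba$ ($a,b\in A$), for every $j\in\mathbb{Z}$ there are isomorphisms of $k$-vector spaces $$HH_j(A)\simeq\begin{cases}A/[A,A] & j=0\\ 0&\text{otherwise,}\end{cases}\qquad HC_j(A)\simeq\begin{cases}A/[A,A] & j\ge 0 \text{ even}\\ 0&\text{otherwise,}\end{cases}$$ $$HP_j(A)\simeq\begin{cases}A/[A,A] & j \text{ even}\\ 0& j\text{ odd,}\end{cases}\qquad HN_j(A)\simeq\begin{cases}A/[A,A] & j\le 0 \text{ even}\\ 0&\text{otherwise.}\end{cases}$$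 -/

import Mathlib

open CategoryTheory TensorProduct

universe u

namespace CyclicHomology

/-- A `k`-algebra `A` is separable if `A` is projective as an `A`-`A`-bimodule, that is, as a module
over `A ⊗ Aᵐᵒᵖ` with `(a ⊗ b) • x = a * x * b`. -/
def IsSeparableAlgebra (k A : Type u) [Field k] [Ring A] [Algebra k A] : Prop :=
  letI : Module (A ⊗[k] Aᵐᵒᵖ) A := TensorProduct.Algebra.module
  Module.Projective (A ⊗[k] Aᵐᵒᵖ) A

section Cyclic

variable (k A : Type u) [Field k] [Ring A] [Algebra k A]

/-- The tensor power `A^{⊗(n+1)}` over `k`. -/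
abbrev TPow (n : ℕ) : Type u := ⨂[k] _ : Fin (n + 1), A

variable {A} in
theorem contractNth_update {n : ℕ} (i : Fin (n + 1)) (a : Fin (n + 2) → A) (l : Fin (n + 2))
    (x : A) :
    Fin.contractNth i.castSucc (· * ·) (Function.update a l x) =
      Function.update (Fin.contractNth i.castSucc (· * ·) a) (i.predAbove l)
        (if l = i.castSucc then x * a i.succ else if l = i.succ then a i.castSucc * x else x) := by
  funext j
  rcases i with ⟨i, hi⟩
  rcases j with ⟨j, hj⟩
  rcases l with ⟨l, hl⟩
  simp only [Fin.contractNth, Function.update_apply, Fin.predAbove, Fin.ext_iff, Fin.lt_def,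
    Fin.castSucc_mk, Fin.succ_mk]
  split_ifs <;> simp_all <;> grind

section

variable {k : Type u} [Field k] {M N P : Type u} [AddCommGroup M] [AddCommGroup N]
  [AddCommGroup P] [Module k M] [Module k N] [Module k P] {ι : Type*}

theorem sum_lcomp (s : Finset ι) (f : ι → N →ₗ[k] P) (g : M →ₗ[k] N) :
    (∑ i ∈ s, f i) ∘ₗ g = ∑ i ∈ s, f i ∘ₗ g := by
  ext; simp

theorem lcomp_sum (s : Finset ι) (f : ι → M →ₗ[k] N) (g : N →ₗ[k] P) :
    g ∘ₗ (∑ i ∈ s, f i) = ∑ i ∈ s, g ∘ₗ f i := by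
  ext; simp

end

/-- The inner face `a₀ ⊗ ⋯ ⊗ aₙ₊₁ ↦ a₀ ⊗ ⋯ ⊗ aᵢaᵢ₊₁ ⊗ ⋯ ⊗ aₙ₊₁`, for `0 ≤ i ≤ n`. -/
noncomputable def contract {n : ℕ} (i : Fin (n + 1)) : TPow k A (n + 1) →ₗ[k] TPow k A n :=
  PiTensorProduct.lift
    { toFun := fun a => PiTensorProduct.tprod k (Fin.contractNth i.castSucc (· * ·) a)
      map_update_add' := by
        intro inst a l x y
        obtain rfl : inst = instDecidableEqFin _ := Subsingleton.elim _ _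
        simp only [contractNth_update]
        rw [← MultilinearMap.map_update_add]
        congr 2
        split_ifs <;> simp [add_mul, mul_add]
      map_update_smul' := by
        intro inst a l c x
        obtain rfl : inst = instDecidableEqFin _ := Subsingleton.elim _ _
        simp only [contractNth_update]
        rw [← MultilinearMap.map_update_smul]
        congr 2
        split_ifs <;> simp }

theorem contract_tprod {n : ℕ} (i : Fin (n + 1)) (a : Fin (n + 2) → A) :
    contract k A i (PiTensorProduct.tprod k a) =
      PiTensorProduct.tprod k (Fin.contractNth i.castSucc (· * ·) a) :=
  PiTensorProduct.lift.tprod _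


/-- The unsigned rotation `a₀ ⊗ ⋯ ⊗ aₙ ↦ aₙ ⊗ a₀ ⊗ ⋯ ⊗ aₙ₋₁`. -/
noncomputable def rot (n : ℕ) : Module.End k (TPow k A n) :=
  (PiTensorProduct.reindex k (fun _ => A) (finRotate (n + 1))).toLinearMap

theorem rot_tprod {n : ℕ} (a : Fin (n + 1) → A) :
    rot k A n (PiTensorProduct.tprod k a) = PiTensorProduct.tprod k
      (fun j : Fin (n + 1) => a ⟨if (j : ℕ) = 0 then n else j - 1, by split_ifs <;> omega⟩) := by
  refine (PiTensorProduct.reindex_tprod _ _).trans ?_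
  congr 1
  funext j
  congr 1
  rw [Equiv.symm_apply_eq, finRotate_apply]
  rcases Fin.eq_zero_or_eq_succ j with rfl | ⟨l, rfl⟩
  · simp [Fin.ext_iff, Fin.val_add]
  · have := l.isLt
    simp [Fin.ext_iff, Fin.val_add, Nat.mod_eq_of_lt]

/-- The face maps `dᵢ` of the cyclic bar construction, for `0 ≤ i ≤ n + 1`: the inner faces for
`i ≤ n`, and `dₙ₊₁ (a₀ ⊗ ⋯ ⊗ aₙ₊₁) = aₙ₊₁a₀ ⊗ a₁ ⊗ ⋯ ⊗ aₙ`. -/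
noncomputable def face {n : ℕ} (i : Fin (n + 2)) : TPow k A (n + 1) →ₗ[k] TPow k A n :=
  Fin.lastCases (motive := fun _ => TPow k A (n + 1) →ₗ[k] TPow k A n)
    (contract k A 0 ∘ₗ rot k A (n + 1)) (fun j => contract k A j) i

theorem face_last {n : ℕ} :
    face k A (Fin.last (n + 1)) = contract k A 0 ∘ₗ rot k A (n + 1) := by
  simp [face]

theorem face_castSucc {n : ℕ} (i : Fin (n + 1)) : face k A i.castSucc = contract k A i := by
  simp [face]

/-- The extra degeneracy `s : a₀ ⊗ ⋯ ⊗ aₙ ↦ 1 ⊗ a₀ ⊗ ⋯ ⊗ aₙ`. -/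
noncomputable def extraDeg (n : ℕ) : TPow k A n →ₗ[k] TPow k A (n + 1) :=
  PiTensorProduct.lift ((PiTensorProduct.tprod k (s := fun _ : Fin (n + 2) => A)).curryLeft 1)

theorem extraDeg_tprod {n : ℕ} (a : Fin (n + 1) → A) :
    extraDeg k A n (PiTensorProduct.tprod k a) =
      PiTensorProduct.tprod k (Fin.cons 1 a : Fin (n + 2) → A) :=
  PiTensorProduct.lift.tprod _

/-- The cyclic operator `t (a₀ ⊗ ⋯ ⊗ aₙ) = (-1)ⁿ aₙ ⊗ a₀ ⊗ ⋯ ⊗ aₙ₋₁`. -/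
noncomputable def cyc (n : ℕ) : Module.End k (TPow k A n) := (-1 : k) ^ n • rot k A n

/-- The norm operator `N = 1 + t + ⋯ + tⁿ`. -/
noncomputable def normOp (n : ℕ) : Module.End k (TPow k A n) :=
  ∑ i ∈ Finset.range (n + 1), cyc k A n ^ i

/-- The Hochschild boundary `b = ∑_{i=0}^{n+1} (-1)ⁱ dᵢ`. -/
noncomputable def hochschildB (n : ℕ) : TPow k A (n + 1) →ₗ[k] TPow k A n :=
  ∑ i : Fin (n + 2), (-1 : k) ^ (i : ℕ) • face k A i

/-- The bar boundary `b' = ∑_{i=0}^{n} (-1)ⁱ dᵢ`. -/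
noncomputable def barB (n : ℕ) : TPow k A (n + 1) →ₗ[k] TPow k A n :=
  ∑ i : Fin (n + 1), (-1 : k) ^ (i : ℕ) • contract k A i

/-- Connes' operator `B = (1 - t) s N`. -/
noncomputable def connesB (n : ℕ) : TPow k A n →ₗ[k] TPow k A (n + 1) :=
  (1 - cyc k A (n + 1)) ∘ₗ extraDeg k A n ∘ₗ normOp k A n

theorem contract_contract {n : ℕ} {i j : Fin (n + 1)} (h : i ≤ j) :
    contract k A i ∘ₗ contract k A j.succ = contract k A j ∘ₗ contract k A i.castSucc := by
  ext a
  simp only [LinearMap.compMultilinearMap_apply, LinearMap.comp_apply, contract_tprod]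
  congr 1
  funext l
  rcases i with ⟨i, hi⟩
  rcases j with ⟨j, hj⟩
  rcases l with ⟨l, hl⟩
  simp only [Fin.contractNth, Fin.castSucc_mk, Fin.succ_mk, Fin.mk_le_mk]
    at h ⊢
  split_ifs <;> first | rfl | omega | simp only [mul_assoc]

theorem contract_rot {n : ℕ} (i : Fin n) :
    contract k A i.succ ∘ₗ rot k A (n + 1) = rot k A n ∘ₗ contract k A i.castSucc := by
  ext a
  obtain ⟨a, rfl⟩ : ∃ a' : ℕ → A, a = fun j : Fin (n + 1 + 1) => a' j :=
    ⟨fun m => if h : m < n + 1 + 1 then a ⟨m, h⟩ else 0, by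
      ext j
      simp only [j.isLt, dif_pos]⟩
  simp only [LinearMap.compMultilinearMap_apply, LinearMap.comp_apply, contract_tprod, rot_tprod]
  refine congrArg _ (funext fun l => ?_)
  rcases i with ⟨i, hi⟩
  rcases l with ⟨l, hl⟩
  simp only [Fin.contractNth, Fin.castSucc_mk, Fin.succ_mk]
  grind

theorem contract_rot_rot {n : ℕ} :
    contract k A 0 ∘ₗ rot k A (n + 1) ∘ₗ rot k A (n + 1) =
      rot k A n ∘ₗ contract k A (Fin.last n) := by
  ext a
  obtain ⟨a, rfl⟩ : ∃ a' : ℕ → A, a = fun j : Fin (n + 1 + 1) => a' j :=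
    ⟨fun m => if h : m < n + 1 + 1 then a ⟨m, h⟩ else 0, by
      ext j
      simp only [j.isLt, dif_pos]⟩
  simp only [LinearMap.compMultilinearMap_apply, LinearMap.comp_apply, contract_tprod, rot_tprod]
  refine congrArg _ (funext fun l => ?_)
  rcases l with ⟨l, hl⟩
  simp only [Fin.contractNth, Fin.castSucc_mk, Fin.succ_mk, Fin.val_castSucc, Fin.val_zero,
    Fin.val_last]
  grind

theorem rot_pow_tprod {n : ℕ} (m : ℕ) (hm : m ≤ n + 1) (a : Fin (n + 1) → A) :
    (rot k A n ^ m) (PiTensorProduct.tprod k a) = PiTensorProduct.tprod k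
      (fun j : Fin (n + 1) => a ⟨if (j : ℕ) < m then j + (n + 1) - m else j - m, by split_ifs <;> omega⟩) := by
  induction m with
  | zero => simp
  | succ m ih =>
    rw [pow_succ', Module.End.mul_apply, ih (by omega), rot_tprod]
    congr 1
    funext j
    rcases j with ⟨j, hj⟩
    simp only []
    refine congrArg a (Fin.ext ?_)
    simp only []
    split_ifs <;> omega

theorem rot_pow_card (n : ℕ) : rot k A n ^ (n + 1) = 1 := by
  ext a
  simp only [LinearMap.compMultilinearMap_apply, rot_pow_tprod k A (n + 1) le_rfl]
  refine congrArg _ (funext fun j => congrArg a (Fin.ext ?_))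
  have := j.isLt
  simp only []
  split_ifs
  omega

theorem cyc_pow_card (n : ℕ) : cyc k A n ^ (n + 1) = 1 := by
  rw [cyc, smul_pow, rot_pow_card, ← pow_mul, (Nat.even_mul_succ_self n).neg_one_pow, one_smul]

theorem cyc_mul_norm (n : ℕ) : cyc k A n * normOp k A n = normOp k A n := by
  have h := mul_neg_geom_sum (cyc k A n) (n + 1)
  rw [cyc_pow_card, sub_self, sub_mul, one_mul, sub_eq_zero] at h
  exact h.symm

theorem norm_mul_cyc (n : ℕ) : normOp k A n * cyc k A n = normOp k A n := by
  have h := geom_sum_mul_neg (cyc k A n) (n + 1)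
  rw [cyc_pow_card, sub_self, mul_sub, mul_one, sub_eq_zero] at h
  exact h.symm

theorem face_face {n : ℕ} {i j : Fin (n + 2)} (h : i ≤ j) :
    face k A i ∘ₗ face k A j.succ = face k A j ∘ₗ face k A i.castSucc := by
  induction j using Fin.lastCases with
  | cast j =>
    obtain ⟨i, rfl⟩ : ∃ i' : Fin (n + 1), i'.castSucc = i :=
      ⟨i.castLT (lt_of_le_of_lt h j.castSucc_lt_last), rfl⟩
    rw [Fin.succ_castSucc]
    simp only [face_castSucc]
    exact contract_contract k A h
  | last =>
    have key : contract k A (0 : Fin (n + 1)) ∘ₗ contract k A 1 =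
        contract k A 0 ∘ₗ contract k A 0 := by
      simpa using contract_contract k A (le_refl (0 : Fin (n + 1)))
    rw [Fin.succ_last, face_last, face_last, face_castSucc]
    induction i using Fin.lastCases with
    | cast i =>
      rw [face_castSucc, LinearMap.comp_assoc, ← contract_rot, ← LinearMap.comp_assoc,
        ← LinearMap.comp_assoc, ← Fin.castSucc_zero, contract_contract k A (Fin.zero_le i)]
    | last =>
      have h2 : contract k A (1 : Fin (n + 2)) ∘ₗ rot k A (n + 2) =
        rot k A (n + 1) ∘ₗ contract k A 0 := by
        simpa using contract_rot k A (0 : Fin (n + 1))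
      rw [face_last, LinearMap.comp_assoc (contract k A (Fin.last _)), ← contract_rot_rot]
      rw [LinearMap.comp_assoc, ← LinearMap.comp_assoc (rot k A (n + 1 + 1)), ← h2,
        LinearMap.comp_assoc, ← LinearMap.comp_assoc, key]
      rfl

theorem hochschildB_comp (n : ℕ) : hochschildB k A n ∘ₗ hochschildB k A (n + 1) = 0 := by
  simp only [hochschildB, lcomp_sum, sum_lcomp]
  rw [Finset.sum_comm, ← Finset.sum_product']
  let P := Fin (n + 2) × Fin (n + 3)
  let S : Finset P := {ij : P | (ij.2 : ℕ) ≤ (ij.1 : ℕ)}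
  rw [Finset.univ_product_univ, ← Finset.sum_add_sum_compl S, ← eq_neg_iff_add_eq_zero, ← Finset.sum_neg_distrib]
  let φ : ∀ ij : P, ij ∈ S → P := fun ij hij =>
    (Fin.castLT ij.2 (lt_of_le_of_lt (Finset.mem_filter.mp hij).right (Fin.is_lt ij.1)), ij.1.succ)
  apply Finset.sum_bij φ
  · intro ij hij
    simp_rw [S, φ, Finset.compl_filter, Finset.mem_filter_univ, Fin.val_succ,
      Fin.val_castLT] at hij ⊢
    lia
  · rintro ⟨i, j⟩ hij ⟨i', j'⟩ hij' h
    rw [Prod.mk_inj]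
    exact ⟨by simpa [φ] using! congr_arg Prod.snd h,
      by simpa [φ, Fin.castSucc_castLT] using! congr_arg Fin.castSucc (congr_arg Prod.fst h)⟩
  · rintro ⟨i', j'⟩ hij'
    simp_rw [S, Finset.compl_filter, Finset.mem_filter_univ, not_le] at hij'
    refine ⟨(j'.pred <| ?_, Fin.castSucc i'), ?_, ?_⟩
    · rintro rfl
      simp only [Fin.val_zero, not_lt_zero] at hij'
    · simpa [S] using! Nat.le_sub_one_of_lt hij'
    · simp only [φ, Fin.castLT_castSucc, Fin.succ_pred]
  · rintro ⟨i, j⟩ hij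
    have hij' : (j : ℕ) ≤ i := (Finset.mem_filter.mp hij).right
    have hj : (j : ℕ) < n + 2 := lt_of_le_of_lt hij' i.isLt
    have key := face_face k A (i := j.castLT hj) (j := i) hij'
    rw [Fin.castSucc_castLT] at key
    simp only [φ, LinearMap.smul_comp, LinearMap.comp_smul, smul_smul, key, ← neg_smul,
      ← pow_add, Fin.val_succ, Fin.val_castLT]
    congr 1
    rw [show (i : ℕ) + 1 + j = j + i + 1 by ring, pow_succ]
    ring

theorem contract_cyc {n : ℕ} (i : Fin n) :
    ((-1 : k) ^ (i.succ : ℕ) • contract k A i.succ) ∘ₗ cyc k A (n + 1) =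
      cyc k A n ∘ₗ ((-1 : k) ^ (i : ℕ) • contract k A i.castSucc) := by
  simp only [cyc, LinearMap.smul_comp, LinearMap.comp_smul, contract_rot, smul_smul, ← pow_add]
  congr 1
  simp only [Fin.val_succ]
  rw [show n + 1 + ((i : ℕ) + 1) = i + n + 2 by ring]
  simp [pow_add]

theorem face_last_cyc (n : ℕ) :
    ((-1 : k) ^ (n + 1) • face k A (Fin.last (n + 1))) = contract k A 0 ∘ₗ cyc k A (n + 1) := by
  simp only [cyc, LinearMap.comp_smul, face_last]

theorem contract_cyc_cyc (n : ℕ) :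
    contract k A 0 ∘ₗ cyc k A (n + 1) ∘ₗ cyc k A (n + 1) =
      cyc k A n ∘ₗ ((-1 : k) ^ n • contract k A (Fin.last n)) := by
  simp only [cyc, LinearMap.smul_comp, LinearMap.comp_smul, contract_rot_rot, smul_smul, ← pow_add]
  congr 1
  rw [show n + 1 + (n + 1) = n + n + 2 by ring]
  simp [pow_add]

theorem hochschildB_eq (n : ℕ) :
    hochschildB k A n = barB k A n + contract k A 0 ∘ₗ cyc k A (n + 1) := by
  rw [hochschildB, barB, Fin.sum_univ_castSucc, ← face_last_cyc]
  simp [face_castSucc]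

theorem hochschildB_one_sub_cyc (n : ℕ) :
    hochschildB k A n ∘ₗ (1 - cyc k A (n + 1)) = (1 - cyc k A n) ∘ₗ barB k A n := by
  have h : barB k A n ∘ₗ cyc k A (n + 1) + contract k A 0 ∘ₗ cyc k A (n + 1) ∘ₗ cyc k A (n + 1) =
      contract k A 0 ∘ₗ cyc k A (n + 1) + cyc k A n ∘ₗ barB k A n := by
    conv_lhs => rw [barB, Fin.sum_univ_succ]
    conv_rhs => rw [barB, Fin.sum_univ_castSucc]
    rw [contract_cyc_cyc, LinearMap.add_comp, LinearMap.comp_add, sum_lcomp,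
      lcomp_sum]
    simp only [contract_cyc, Fin.val_castSucc, Fin.val_last, Fin.val_zero, pow_zero, one_smul]
    abel
  rw [LinearMap.comp_sub, LinearMap.sub_comp, hochschildB_eq]
  simp only [Module.End.one_eq_id, LinearMap.comp_id, LinearMap.id_comp, LinearMap.add_comp]
  rw [LinearMap.comp_assoc, h]
  abel

theorem contract_cyc_pow {n : ℕ} (i : Fin (n + 1)) :
    ((-1 : k) ^ (i : ℕ) • contract k A i) ∘ₗ (cyc k A (n + 1) ^ (i : ℕ)) =
      (cyc k A n ^ (i : ℕ)) ∘ₗ contract k A 0 := by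
  induction i using Fin.inductionOn with
  | zero => simp [Module.End.one_eq_id]
  | succ i ih =>
    have h := contract_cyc k A i
    rw [Fin.val_castSucc] at ih
    rw [Fin.val_succ] at h ⊢
    rw [pow_succ' (cyc k A (n + 1)), pow_succ' (cyc k A n), Module.End.mul_eq_comp,
      Module.End.mul_eq_comp, ← LinearMap.comp_assoc, h, LinearMap.comp_assoc, ih]
    rfl

theorem cyc_pow_mul_norm (n i : ℕ) : cyc k A n ^ i * normOp k A n = normOp k A n := by
  induction i with
  | zero => simp
  | succ i ih => rw [pow_succ, mul_assoc, cyc_mul_norm, ih]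

theorem norm_mul_cyc_pow (n i : ℕ) : normOp k A n * cyc k A n ^ i = normOp k A n := by
  induction i with
  | zero => simp
  | succ i ih => rw [pow_succ', ← mul_assoc, norm_mul_cyc, ih]

theorem barB_norm (n : ℕ) :
    barB k A n ∘ₗ normOp k A (n + 1) = normOp k A n ∘ₗ contract k A 0 ∘ₗ normOp k A (n + 1) := by
  have (i : Fin (n + 1)) : ((-1 : k) ^ (i : ℕ) • contract k A i) ∘ₗ normOp k A (n + 1) =
      (cyc k A n ^ (i : ℕ)) ∘ₗ contract k A 0 ∘ₗ normOp k A (n + 1) := by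
    conv_lhs => rw [← cyc_pow_mul_norm k A (n + 1) i, Module.End.mul_eq_comp]
    rw [← LinearMap.comp_assoc, contract_cyc_pow, LinearMap.comp_assoc]
  rw [barB, sum_lcomp]
  simp only [this]
  rw [← sum_lcomp, normOp, normOp, Finset.sum_range (n := n + 1)]

theorem norm_hochschildB (n : ℕ) :
    normOp k A n ∘ₗ hochschildB k A n = normOp k A n ∘ₗ contract k A 0 ∘ₗ normOp k A (n + 1) := by
  have (i : Fin (n + 1)) : normOp k A n ∘ₗ ((-1 : k) ^ (i : ℕ) • contract k A i) =
      normOp k A n ∘ₗ contract k A 0 ∘ₗ (cyc k A (n + 1) * cyc k A (n + 1) ^ (n + 1 - (i : ℕ))) := by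
    have h : normOp k A n ∘ₗ (((-1 : k) ^ (i : ℕ) • contract k A i) ∘ₗ
        (cyc k A (n + 1) ^ (i : ℕ))) ∘ₗ cyc k A (n + 1) ^ (n + 2 - (i : ℕ)) =
        normOp k A n ∘ₗ ((cyc k A n ^ (i : ℕ)) ∘ₗ contract k A 0) ∘ₗ
          cyc k A (n + 1) ^ (n + 2 - (i : ℕ)) := by
      rw [contract_cyc_pow]
    rw [LinearMap.comp_assoc, ← Module.End.mul_eq_comp (cyc k A (n + 1) ^ _), ← pow_add,
      show (i : ℕ) + (n + 2 - i) = n + 1 + 1 by omega, cyc_pow_card, Module.End.one_eq_id,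
      LinearMap.comp_id, LinearMap.comp_assoc, ← LinearMap.comp_assoc _ _ (normOp k A n),
      ← Module.End.mul_eq_comp, norm_mul_cyc_pow] at h
    rw [h, show n + 2 - (i : ℕ) = n + 1 - i + 1 by omega, pow_succ']
  have h2 : normOp k A (n + 1) = ∑ i : Fin (n + 1),
      cyc k A (n + 1) * cyc k A (n + 1) ^ (n + 1 - (i : ℕ)) + cyc k A (n + 1) := by
    conv_lhs => rw [← cyc_mul_norm, normOp, Finset.sum_range_succ', ← Finset.sum_range_reflect,
      Finset.sum_range, mul_add, pow_zero, mul_one, Finset.mul_sum]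
    congr 1
    refine Finset.sum_congr rfl fun i _ => ?_
    congr 2
    omega
  rw [hochschildB_eq, LinearMap.comp_add, barB, lcomp_sum, h2]
  simp only [this, LinearMap.comp_add, lcomp_sum]

theorem contract_extra_zero (n : ℕ) :
    contract k A 0 ∘ₗ extraDeg k A n = LinearMap.id := by
  ext a
  simp only [LinearMap.compMultilinearMap_apply, LinearMap.comp_apply, contract_tprod,
    extraDeg_tprod, LinearMap.id_apply]
  refine congrArg _ (funext fun l => ?_)
  rcases Fin.eq_zero_or_eq_succ l with rfl | ⟨l, rfl⟩ <;> simp [Fin.contractNth]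

theorem contract_extra_succ {n : ℕ} (i : Fin (n + 1)) :
    contract k A i.succ ∘ₗ extraDeg k A (n + 1) = extraDeg k A n ∘ₗ contract k A i := by
  ext a
  simp only [LinearMap.compMultilinearMap_apply, LinearMap.comp_apply, contract_tprod,
    extraDeg_tprod]
  refine congrArg _ (funext fun l => ?_)
  rcases Fin.eq_zero_or_eq_succ l with rfl | ⟨l, rfl⟩ <;>
    simp [Fin.contractNth]

theorem bar_extra (n : ℕ) :
    barB k A (n + 1) ∘ₗ extraDeg k A (n + 1) + extraDeg k A n ∘ₗ barB k A n = LinearMap.id := by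
  have h (i : Fin (n + 1)) : ((-1 : k) ^ (i.succ : ℕ) • contract k A i.succ) ∘ₗ
      extraDeg k A (n + 1) = -(extraDeg k A n ∘ₗ ((-1 : k) ^ (i : ℕ) • contract k A i)) := by
    rw [LinearMap.smul_comp, LinearMap.comp_smul, contract_extra_succ, Fin.val_succ, pow_succ,
      mul_neg_one]
    exact neg_smul ((-1 : k) ^ (i : ℕ)) (extraDeg k A n ∘ₗ contract k A i)
  rw [barB, Fin.sum_univ_succ, barB, lcomp_sum, LinearMap.add_comp, sum_lcomp]
  simp only [h, Finset.sum_neg_distrib, neg_add_cancel_right]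
  simp [contract_extra_zero]

theorem one_sub_cyc_norm (n : ℕ) : (1 - cyc k A n) ∘ₗ normOp k A n = 0 := by
  rw [← Module.End.mul_eq_comp, sub_mul, one_mul, cyc_mul_norm, sub_self]

theorem norm_one_sub_cyc (n : ℕ) : normOp k A n ∘ₗ (1 - cyc k A n) = 0 := by
  rw [← Module.End.mul_eq_comp, mul_sub, mul_one, norm_mul_cyc, sub_self]

theorem connesB_comp (n : ℕ) : connesB k A (n + 1) ∘ₗ connesB k A n = 0 := by
  rw [connesB, connesB, LinearMap.comp_assoc, LinearMap.comp_assoc,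
    ← LinearMap.comp_assoc _ _ (normOp k A (n + 1)), norm_one_sub_cyc, LinearMap.zero_comp,
    LinearMap.comp_zero, LinearMap.comp_zero]

theorem hochschildB_connesB (n : ℕ) :
    hochschildB k A (n + 1) ∘ₗ connesB k A (n + 1) + connesB k A n ∘ₗ hochschildB k A n = 0 := by
  rw [connesB, connesB, ← LinearMap.comp_assoc, hochschildB_one_sub_cyc,
    LinearMap.comp_assoc, LinearMap.comp_assoc, LinearMap.comp_assoc (hochschildB k A n),
    norm_hochschildB, ← barB_norm, ← LinearMap.comp_add,
    ← LinearMap.comp_assoc, ← LinearMap.comp_assoc, ← LinearMap.add_comp, bar_extra,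
    LinearMap.id_comp, one_sub_cyc_norm]

theorem hochschildB_connesB_zero : hochschildB k A 0 ∘ₗ connesB k A 0 = 0 := by
  have h : barB k A 0 ∘ₗ extraDeg k A 0 = LinearMap.id := by
    simpa [barB] using contract_extra_zero k A 0
  rw [connesB, ← LinearMap.comp_assoc, hochschildB_one_sub_cyc, LinearMap.comp_assoc,
    ← LinearMap.comp_assoc _ _ (barB k A 0), h, LinearMap.id_comp, one_sub_cyc_norm]

end Cyclic
/-- A mixed complex over `k`, that is, a dg module over `Λ = k[ε]/(ε²)` with `ε` of homological
degree `1`: a chain complex `(cx, b)` graded by `ℤ`, with `B` of degree `+1` such that `B² = 0` and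
`bB + Bb = 0`. -/
structure MixedComplex (k : Type u) [Field k] where
  cx : ChainComplex (ModuleCat.{u} k) ℤ
  B : ∀ i j : ℤ, cx.X i ⟶ cx.X j
  B_shape : ∀ i j : ℤ, i + 1 ≠ j → B i j = 0
  B_comp_B : ∀ i j l : ℤ, B i j ≫ B j l = 0
  anticomm : ∀ i : ℤ, B i (i + 1) ≫ cx.d (i + 1) i + cx.d i (i - 1) ≫ B (i - 1) i = 0

namespace MixedComplex

variable {k : Type u} [Field k]

/-- Morphisms of mixed complexes: they commute with `b` and with `B`. -/
@[ext]
structure Hom (M N : MixedComplex k) where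
  hom : M.cx ⟶ N.cx
  comm : ∀ i j : ℤ, hom.f i ≫ N.B i j = M.B i j ≫ hom.f j

instance : Category (MixedComplex k) where
  Hom M N := Hom M N
  id M := ⟨𝟙 M.cx, by simp⟩
  comp f g := ⟨f.hom ≫ g.hom, fun i j => by
    rw [HomologicalComplex.comp_f, HomologicalComplex.comp_f, Category.assoc, g.comm,
      ← Category.assoc, f.comm, Category.assoc]⟩
  id_comp f := Hom.ext (Category.id_comp f.hom)
  comp_id f := Hom.ext (Category.comp_id f.hom)
  assoc f g h := Hom.ext (Category.assoc f.hom g.hom h.hom)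

variable (k) in
/-- The morphisms that induce isomorphisms on the homology with respect to `b`. -/
def quasiIso : MorphismProperty (MixedComplex k) :=
  fun _ _ f => QuasiIso f.hom

/-- The mixed complex `(M ⊗ V, b ⊗ 1, B ⊗ 1)`, for a `k`-vector space `V`. -/
noncomputable def tensor (M : MixedComplex k) (V : ModuleCat.{u} k) : MixedComplex k where
  cx := ((MonoidalCategory.tensorRight V).mapHomologicalComplex _).obj M.cx
  B i j := (MonoidalCategory.tensorRight V).map (M.B i j)
  B_shape i j h := by
    rw [M.B_shape i j h]
    exact Functor.map_zero _ _ _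
  B_comp_B i j l := by
    refine ((MonoidalCategory.tensorRight V).map_comp (M.B i j) (M.B j l)).symm.trans ?_
    rw [M.B_comp_B]
    exact Functor.map_zero _ _ _
  anticomm i := by
    have h := congrArg (MonoidalCategory.tensorRight V).map (M.anticomm i)
    rw [Functor.map_add, Functor.map_comp, Functor.map_comp, Functor.map_zero] at h
    exact h

section OfNat

variable (X : ℕ → ModuleCat.{u} k) (b : ∀ n, X (n + 1) ⟶ X n) (B : ∀ n, X n ⟶ X (n + 1))

/-- A family indexed by `ℕ`, extended by zero to the negative degrees. -/
noncomputable def extX : ℤ → ModuleCat.{u} k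
  | Int.ofNat n => X n
  | Int.negSucc _ => ModuleCat.of k PUnit

/-- The boundary `b`, extended by zero. -/
noncomputable def extb : ∀ n : ℤ, extX X (n + 1) ⟶ extX X n
  | Int.ofNat n => b n
  | Int.negSucc _ => 0

/-- The operator `B`, extended by zero. -/
noncomputable def extB : ∀ n : ℤ, extX X n ⟶ extX X (n + 1)
  | Int.ofNat n => B n
  | Int.negSucc _ => 0

theorem extX_negSucc_hom (n : ℕ) {Y : ModuleCat.{u} k} (f g : Y ⟶ extX X (Int.negSucc n)) :
    f = g := by
  ext x
  exact Subsingleton.elim (α := PUnit) _ _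

/-- The mixed complex, zero in negative degrees, given by data indexed by `ℕ`. -/
noncomputable def ofNat (hb : ∀ n, b (n + 1) ≫ b n = 0) (hB : ∀ n, B n ≫ B (n + 1) = 0)
    (h0 : B 0 ≫ b 0 = 0) (hbB : ∀ n, B (n + 1) ≫ b (n + 1) + b n ≫ B n = 0) :
    MixedComplex k where
  cx := ChainComplex.of (extX X) (extb X b) fun
    | Int.ofNat n => hb n
    | Int.negSucc _ => extX_negSucc_hom _ _ _ _
  B := CochainComplex.of.d (extX X) (extB X B)
  B_shape i j h := CochainComplex.of_d_ne _ _ h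
  B_comp_B i j l := by
    by_cases h1 : i + 1 = j
    · by_cases h2 : j + 1 = l
      · subst h1 h2
        rw [CochainComplex.of_d, CochainComplex.of_d]
        match i with
        | Int.ofNat n => exact hB n
        | Int.negSucc n => exact Limits.zero_comp
      · rw [CochainComplex.of_d_ne _ _ h2, Limits.comp_zero]
    · rw [CochainComplex.of_d_ne _ _ h1, Limits.zero_comp]
  anticomm i := by
    obtain ⟨i, rfl⟩ : ∃ j, i = j + 1 := ⟨i - 1, by simp⟩
    obtain ⟨l, hl⟩ : ∃ l, i + 1 - 1 = l := ⟨_, rfl⟩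
    rw [hl]
    obtain rfl : l = i := by omega
    dsimp only
    rw [ChainComplex.of_d, ChainComplex.of_d, CochainComplex.of_d, CochainComplex.of_d]
    match l with
    | Int.ofNat n => exact hbB n
    | Int.negSucc 0 =>
      have e : extB X B (Int.negSucc 0 + 1) ≫ extb X b (Int.negSucc 0 + 1) = 0 := h0
      rw [e, zero_add]
      exact Limits.comp_zero
    | Int.negSucc (n + 1) => exact extX_negSucc_hom X n _ _

end OfNat

section Total

variable (M : MixedComplex k) 

/-- The component in degree `i` of a family indexed by `P`, read as `0` if `i ∉ P`. -/
noncomputable def prodComponent (P : Set ℤ) [DecidablePred (· ∈ P)] (i : ℤ) :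
    (∀ m : P, M.cx.X m) →ₗ[k] M.cx.X i :=
  if h : i ∈ P then LinearMap.proj (⟨i, h⟩ : P) else 0

/-- The map `b + B` between products of components: the degree `m` entry of the image of `x` is
`b xₘ₊₁ + B xₘ₋₁`, where entries outside `P` count as `0`. -/
noncomputable def prodMap (P Q : Set ℤ) [DecidablePred (· ∈ P)] :
    (∀ m : P, M.cx.X m) →ₗ[k] (∀ m : Q, M.cx.X m) :=
  LinearMap.pi fun m =>
    (M.cx.d (m + 1) m).hom ∘ₗ M.prodComponent P (m + 1) +
      (M.B (m - 1) m).hom ∘ₗ M.prodComponent P (m - 1)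

theorem d_d_apply (i j l : ℤ) (y : M.cx.X i) : (M.cx.d j l).hom ((M.cx.d i j).hom y) = 0 := by
  rw [← ModuleCat.comp_apply, M.cx.d_comp_d]
  rfl

theorem B_B_apply (i j l : ℤ) (y : M.cx.X i) : (M.B j l).hom ((M.B i j).hom y) = 0 := by
  rw [← ModuleCat.comp_apply, M.B_comp_B]
  rfl

theorem anticomm_apply (i : ℤ) (y : M.cx.X i) :
    (M.cx.d (i + 1) i).hom ((M.B i (i + 1)).hom y) +
      (M.B (i - 1) i).hom ((M.cx.d i (i - 1)).hom y) = 0 := by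
  have h := congrArg (fun f => f.hom y) (M.anticomm i)
  exact h

theorem prodComponent_prodMap (P Q : Set ℤ) [DecidablePred (· ∈ P)] [DecidablePred (· ∈ Q)]
    (i : ℤ) (hi : i ∈ Q) (x : ∀ m : P, M.cx.X m) :
    M.prodComponent Q i (M.prodMap P Q x) =
      (M.cx.d (i + 1) i).hom (M.prodComponent P (i + 1) x) +
        (M.B (i - 1) i).hom (M.prodComponent P (i - 1) x) := by
  conv_lhs => rw [prodComponent, dif_pos hi]
  rfl

theorem prodComponent_of_notMem (P : Set ℤ) [DecidablePred (· ∈ P)] (i : ℤ) (hi : i ∉ P)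
    (x : ∀ m : P, M.cx.X m) : M.prodComponent P i x = 0 := by
  rw [prodComponent, dif_neg hi]
  rfl

theorem prodMap_comp (P Q R : Set ℤ) [DecidablePred (· ∈ P)] [DecidablePred (· ∈ Q)]
    (h1 : ∀ m ∈ R, m + 1 ∈ Q) (h2 : ∀ m ∈ R, m ∈ P → m - 1 ∈ Q) :
    M.prodMap Q R ∘ₗ M.prodMap P Q = 0 := by
  refine LinearMap.ext fun x => funext fun ⟨m, hm⟩ => ?_
  change (M.cx.d (m + 1) m).hom (M.prodComponent Q (m + 1) (M.prodMap P Q x)) +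
    (M.B (m - 1) m).hom (M.prodComponent Q (m - 1) (M.prodMap P Q x)) = 0
  have e1 : ∀ i, i = m → (M.B i (m + 1)).hom (M.prodComponent P i x) =
      (M.B m (m + 1)).hom (M.prodComponent P m x) := by rintro i rfl; rfl
  have e2 : ∀ i, i = m → (M.cx.d i (m - 1)).hom (M.prodComponent P i x) =
      (M.cx.d m (m - 1)).hom (M.prodComponent P m x) := by rintro i rfl; rfl
  rw [M.prodComponent_prodMap P Q (m + 1) (h1 m hm), map_add, d_d_apply, zero_add,
    e1 (m + 1 - 1) (by omega)]
  by_cases hQ : m - 1 ∈ Q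
  · rw [M.prodComponent_prodMap P Q (m - 1) hQ, map_add, B_B_apply, add_zero,
      e2 (m - 1 + 1) (by omega), anticomm_apply]
  · rw [M.prodComponent_of_notMem Q _ hQ, map_zero, add_zero,
      M.prodComponent_of_notMem P m fun h => hQ (h2 m hm h), map_zero, map_zero]

/-- The periodic cyclic complex, graded by `ℤ/2`: `∏_{m ≡ p mod 2} Mₘ` with differential `b + B`. -/
noncomputable def periodic : HomologicalComplex (ModuleCat.{u} k) (ComplexShape.down (ZMod 2)) where
  X p := ModuleCat.of k (∀ m : {m : ℤ | (m : ZMod 2) = p}, M.cx.X m)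
  d p q := if q + 1 = p then ModuleCat.ofHom (M.prodMap _ _) else 0
  shape p q h := if_neg h
  d_comp_d' p q r hpq hqr := by
    have hpq' : q + 1 = p := hpq
    have hqr' : r + 1 = q := hqr
    rw [if_pos hpq', if_pos hqr', ← ModuleCat.ofHom_comp, prodMap_comp]
    · rfl
    · rintro m rfl
      simpa using hqr'
    · rintro m rfl hm
      have hm' : (m : ZMod 2) = p := hm
      change ((m - 1 : ℤ) : ZMod 2) = q
      rw [Int.cast_sub, hm', ← hpq']
      simp

/-- The negative cyclic complex: `∏_{i ≥ 0} Mₙ₊₂ᵢ` in degree `n`, with differential `b + B`. -/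
noncomputable def negative : ChainComplex (ModuleCat.{u} k) ℤ where
  X n := ModuleCat.of k (∀ m : {m : ℤ | n ≤ m ∧ Even (m - n)}, M.cx.X m)
  d n l := if l + 1 = n then ModuleCat.ofHom (M.prodMap _ _) else 0
  shape p q h := if_neg h
  d_comp_d' p q r hpq hqr := by
    have hpq' : q + 1 = p := hpq
    have hqr' : r + 1 = q := hqr
    rw [if_pos hpq', if_pos hqr', ← ModuleCat.ofHom_comp, prodMap_comp]
    · rfl
    · rintro m ⟨h, h'⟩
      refine ⟨by omega, ?_⟩
      rw [← hqr']
      simpa using h'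
    · rintro m - ⟨h, h'⟩
      refine ⟨by omega, ?_⟩
      rw [← hpq'] at h'
      rwa [show m - 1 - q = m - (q + 1) by ring]

/-- The inclusion of the degree `i` component in a direct sum over `Q`, read as `0` if `i ∉ Q`. -/
noncomputable def sumIncl (Q : Set ℤ) [DecidablePred (· ∈ Q)] (i : ℤ) :
    M.cx.X i →ₗ[k] DirectSum Q fun m => M.cx.X m :=
  if h : i ∈ Q then DirectSum.lof k Q (fun m => M.cx.X m) ⟨i, h⟩ else 0

/-- The map `b + B` between direct sums of components, where values outside `Q` are dropped. -/
noncomputable def sumMap (P Q : Set ℤ) [DecidablePred (· ∈ Q)] :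
    (DirectSum P fun m => M.cx.X m) →ₗ[k] (DirectSum Q fun m => M.cx.X m) :=
  DirectSum.toModule k P _ fun m =>
    M.sumIncl Q (m - 1) ∘ₗ (M.cx.d m (m - 1)).hom +
      M.sumIncl Q (m + 1) ∘ₗ (M.B m (m + 1)).hom

theorem sumMap_sumIncl (Q R : Set ℤ) [DecidablePred (· ∈ Q)] [DecidablePred (· ∈ R)] (i : ℤ)
    (hi : i ∈ Q) (y : M.cx.X i) :
    M.sumMap Q R (M.sumIncl Q i y) = M.sumIncl R (i - 1) ((M.cx.d i (i - 1)).hom y) +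
      M.sumIncl R (i + 1) ((M.B i (i + 1)).hom y) := by
  conv_lhs => rw [sumIncl, dif_pos hi, sumMap, DirectSum.toModule_lof]
  rfl

theorem sumIncl_of_notMem (Q : Set ℤ) [DecidablePred (· ∈ Q)] (i : ℤ)
    (hi : i ∉ Q) (y : M.cx.X i) : M.sumIncl Q i y = 0 := by
  rw [sumIncl, dif_neg hi]
  rfl

theorem sumMap_comp (P Q R : Set ℤ) [DecidablePred (· ∈ Q)] [DecidablePred (· ∈ R)]
    (h1 : ∀ m ∈ P, m - 1 ∈ Q) (h2 : ∀ m ∈ P, m ∈ R → m + 1 ∈ Q) :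
    M.sumMap Q R ∘ₗ M.sumMap P Q = 0 := by
  refine DirectSum.linearMap_ext k fun ⟨m, hm⟩ => LinearMap.ext fun y => ?_
  have e0 : M.sumMap P Q (DirectSum.lof k P (fun m => M.cx.X m) ⟨m, hm⟩ y) =
      M.sumIncl Q (m - 1) ((M.cx.d m (m - 1)).hom y) +
        M.sumIncl Q (m + 1) ((M.B m (m + 1)).hom y) := by
    rw [sumMap, DirectSum.toModule_lof]
    rfl
  have e1 : ∀ i, i = m → M.sumIncl R i ((M.B (m - 1) i).hom ((M.cx.d m (m - 1)).hom y)) =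
      M.sumIncl R m ((M.B (m - 1) m).hom ((M.cx.d m (m - 1)).hom y)) := by rintro i rfl; rfl
  have e2 : ∀ i, i = m → M.sumIncl R i ((M.cx.d (m + 1) i).hom ((M.B m (m + 1)).hom y)) =
      M.sumIncl R m ((M.cx.d (m + 1) m).hom ((M.B m (m + 1)).hom y)) := by rintro i rfl; rfl
  change M.sumMap Q R (M.sumMap P Q (DirectSum.lof k P (fun m => M.cx.X m) ⟨m, hm⟩ y)) = 0
  rw [e0, map_add, M.sumMap_sumIncl Q R (m - 1) (h1 m hm), d_d_apply, map_zero, zero_add,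
    e1 _ (by omega)]
  by_cases hQ : m + 1 ∈ Q
  · rw [M.sumMap_sumIncl Q R (m + 1) hQ, B_B_apply, map_zero, add_zero, e2 _ (by omega),
      ← map_add, add_comm, anticomm_apply, map_zero]
  · rw [M.sumIncl_of_notMem Q _ hQ, map_zero, add_zero,
      M.sumIncl_of_notMem R m fun h => hQ (h2 m hm h)]

/-- The cyclic complex: `⨁_{i ≥ 0} Mₙ₋₂ᵢ` in degree `n`, with differential `b + B`. -/
noncomputable def cyclic : ChainComplex (ModuleCat.{u} k) ℤ where
  X n := ModuleCat.of k (DirectSum {m : ℤ | m ≤ n ∧ Even (n - m)} fun m => M.cx.X m)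
  d n l := if l + 1 = n then ModuleCat.ofHom (M.sumMap _ _) else 0
  shape p q h := if_neg h
  d_comp_d' p q r hpq hqr := by
    have hpq' : q + 1 = p := hpq
    have hqr' : r + 1 = q := hqr
    rw [if_pos hpq', if_pos hqr', ← ModuleCat.ofHom_comp, sumMap_comp]
    · rfl
    · rintro m ⟨h, h'⟩
      refine ⟨by omega, ?_⟩
      rw [← hpq'] at h'
      rwa [show q - (m - 1) = q + 1 - m by ring]
    · rintro m - ⟨h, h'⟩
      refine ⟨by omega, ?_⟩
      rw [← hqr']
      simpa using h'

end Total

end MixedComplex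
/-- The functor to the derived category `𝒟(Λ)` of mixed complexes, the localization of mixed complexes
at the quasi-isomorphisms. -/
noncomputable abbrev toDMixed (k : Type u) [Field k] :
    MixedComplex k ⥤ (MixedComplex.quasiIso k).Localization :=
  (MixedComplex.quasiIso k).Q

/-- The functor to the derived category of complexes of `k`-vector spaces of a given shape, the
localization at the quasi-isomorphisms: `𝒟(k)` for chain complexes graded by `ℤ`, and `𝒟_{ℤ/2}(k)`
for complexes graded by `ℤ/2`. -/
noncomputable abbrev toD (k : Type u) [Field k] {ι : Type} (c : ComplexShape ι) :
    HomologicalComplex (ModuleCat.{u} k) c ⥤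
      (HomologicalComplex.quasiIso (ModuleCat.{u} k) c).Localization :=
  (HomologicalComplex.quasiIso (ModuleCat.{u} k) c).Q

/-- The complex `K ⊗ V`, for a `k`-vector space `V`. -/
noncomputable abbrev tensorComplex {k : Type u} [Field k] {ι : Type} {c : ComplexShape ι}
    (K : HomologicalComplex (ModuleCat.{u} k) c) (V : ModuleCat.{u} k) :
    HomologicalComplex (ModuleCat.{u} k) c :=
  ((MonoidalCategory.tensorRight V).mapHomologicalComplex c).obj K

section Invariants

variable (k A : Type u) [Field k] [Ring A] [Algebra k A]

/-- The mixed complex `C(A) = (A^{⊗(n+1)}, b, B)` of the `k`-algebra `A`. -/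
noncomputable def C : MixedComplex k :=
  MixedComplex.ofNat (fun n => ModuleCat.of k (TPow k A n))
    (fun n => ModuleCat.ofHom (hochschildB k A n)) (fun n => ModuleCat.ofHom (connesB k A n))
    (fun n => by rw [← ModuleCat.ofHom_comp, hochschildB_comp]; rfl)
    (fun n => by rw [← ModuleCat.ofHom_comp, connesB_comp]; rfl)
    (by rw [← ModuleCat.ofHom_comp, hochschildB_connesB_zero]; rfl)
    (fun n => by
      rw [← ModuleCat.ofHom_comp, ← ModuleCat.ofHom_comp, ← ModuleCat.ofHom_add,
        hochschildB_connesB]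
      rfl)

/-- The Hochschild complex of `A`. -/
noncomputable def HH : ChainComplex (ModuleCat.{u} k) ℤ := (C k A).cx

/-- The cyclic homology complex of `A`. -/
noncomputable def HC : ChainComplex (ModuleCat.{u} k) ℤ := (C k A).cyclic

/-- The periodic cyclic homology complex of `A`. -/
noncomputable def HP : HomologicalComplex (ModuleCat.{u} k) (ComplexShape.down (ZMod 2)) :=
  (C k A).periodic

/-- The negative cyclic homology complex of `A`. -/
noncomputable def HN : ChainComplex (ModuleCat.{u} k) ℤ := (C k A).negative

/-- The `k`-vector space `HH₀(A)`. -/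
noncomputable def HH0 : ModuleCat.{u} k := (HH k A).homology 0

/-- The `k`-vector space `A/[A,A]`, where `[A,A]` is spanned by the commutators `ab - ba`. -/
noncomputable def commutatorQuotient : ModuleCat.{u} k :=
  ModuleCat.of k (A ⧸ Submodule.span k (Set.range fun p : A × A => p.1 * p.2 - p.2 * p.1))

end Invariants

end CyclicHomology

/-!
A separable algebra `A` has a separability idempotent `e = ∑ xᵢ ⊗ yᵢ ∈ A ⊗ A`, that is,
`∑ xᵢ yᵢ = 1` and `∑ a xᵢ ⊗ yᵢ = ∑ xᵢ ⊗ yᵢ a`: the image of `1` under a bimodule section of the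
multiplication (`IsSeparableAlgebra.exists_idempotent`). The map
`h (a₀ ⊗ ⋯ ⊗ aₙ) = ∑ a₀xᵢ ⊗ yᵢ ⊗ a₁ ⊗ ⋯ ⊗ aₙ` satisfies `d₀ h = 1` and `dᵢ₊₁ h = h dᵢ`, so that
`b h + h b = 1` in positive degrees (`IsSeparabilityIdempotent.hochschildB_insertion`). Hence the
Hochschild complex is exact in positive degrees, and `C(A)` resolves `A/[A,A]` in the sense of
`MixedComplex.Resolves`. The same holds for `k` itself with `e = 1 ⊗ 1`, and resolutions are stable
under `⊗ W`, so `C(k) ⊗ HH₀(A)` resolves `HH₀(A) ≃ A/[A,A]` too.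

A mixed complex `M` that resolves `V` maps onto `V`, placed in degree `0` with zero operators, and
this is a quasi-isomorphism of mixed complexes (`Resolves.quasiIso_augmentation`). Two resolutions
of the same `V` are therefore isomorphic in `𝒟(Λ)`.

The homology of the cyclic, negative and periodic complexes of `M` is computed for all three
at once. An element of any of them is a family `(xₘ)`, `xₘ ∈ Mₘ`, supported on a set of degrees,
and the differential is `b + B` with the values outside the next set dropped. The equation
`b wₘ₊₁ + B wₘ₋₁ = zₘ` for a cycle `z` is solved upwards from degree `0`: in positive degrees
`zₘ - B wₘ₋₁` is `b`-closed by induction, hence `b`-exact, and the only obstruction is the class of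
`z₀` in `V` (`Resolves.exists_primitive`). The homology is therefore `V` where degree `0`
occurs in the complex, and `0` elsewhere.

Over a field, every complex is quasi-isomorphic to its homology with zero differential, so complexes
with isomorphic homology are isomorphic in the derived category (`nonempty_toD_iso`); as `⊗ W` is
exact, the remaining isomorphisms follow from the computation of the homology. Comparing homology
avoids any interchange of `⊗ W` with the infinite products in `HN` and `HP`.
-/

/-! ### Homology of complexes of vector spaces -/

namespace CyclicHomology

section Homology

variable {k : Type u} [Field k] {ι : Type} {c : ComplexShape ι}

/-- The homology of `K` in degree `j` is `V` as soon as some `φ : Kⱼ → V` kills the boundaries, maps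
the cycles onto `V`, and has only boundaries among the cycles in its kernel. -/
theorem nonempty_homology_iso (K : HomologicalComplex (ModuleCat.{u} k) c) {i j l : ι}
    (hij : c.Rel i j) (hjl : c.Rel j l) (V : ModuleCat.{u} k) (φ : K.X j →ₗ[k] V)
    (h0 : ∀ y : K.X i, φ ((K.d i j).hom y) = 0)
    (hinj : ∀ x : K.X j, (K.d j l).hom x = 0 → φ x = 0 → ∃ y : K.X i, (K.d i j).hom y = x)
    (hsurj : ∀ v : V, ∃ x : K.X j, (K.d j l).hom x = 0 ∧ φ x = v) :
    Nonempty (K.homology j ≅ V) := by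
  obtain rfl := c.prev_eq' hij
  obtain rfl := c.next_eq' hjl
  let S := K.sc j
  let ψ : LinearMap.ker S.g.hom →ₗ[k] V := φ ∘ₗ (LinearMap.ker S.g.hom).subtype
  have hψ : LinearMap.range S.moduleCatToCycles = LinearMap.ker ψ := by
    ext x
    constructor
    · rintro ⟨y, rfl⟩
      exact h0 y
    · intro hx
      obtain ⟨y, hy⟩ := hinj x.1 x.2 hx
      exact ⟨y, Subtype.ext hy⟩
  have hψs : Function.Surjective ψ := fun v => by
    obtain ⟨x, hx, rfl⟩ := hsurj v
    exact ⟨⟨x, hx⟩, rfl⟩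
  exact ⟨S.moduleCatHomologyIso ≪≫ LinearEquiv.toModuleIso
    ((Submodule.quotEquivOfEq _ _ hψ).trans (ψ.quotKerEquivOfSurjective hψs))⟩

theorem isZero_homology (K : HomologicalComplex (ModuleCat.{u} k) c) {i j l : ι}
    (hij : c.Rel i j) (hjl : c.Rel j l)
    (h : ∀ x : K.X j, (K.d j l).hom x = 0 → ∃ y : K.X i, (K.d i j).hom y = x) :
    Limits.IsZero (K.homology j) := by
  obtain ⟨e⟩ := nonempty_homology_iso K hij hjl (ModuleCat.of k PUnit) 0 (fun _ => rfl)
    (fun x hx _ => h x hx) (fun v => ⟨0, map_zero _, rfl⟩)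
  exact (ModuleCat.isZero_of_subsingleton (ModuleCat.of k PUnit)).of_iso e

/-- The homology of `K`, as a complex with zero differential. -/
noncomputable def homologyComplex (K : HomologicalComplex (ModuleCat.{u} k) c) :
    HomologicalComplex (ModuleCat.{u} k) c where
  X i := K.homology i
  d _ _ := 0

/-- The quasi-isomorphism `H(K) → K` given by a choice of cycles representing each
homology class. -/
noncomputable def homologyComplexTo (K : HomologicalComplex (ModuleCat.{u} k) c) :
    homologyComplex K ⟶ K where
  f i := Projective.factorThru (P := K.homology i) (𝟙 _) (K.homologyπ i) ≫ K.iCycles i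
  comm' i j _ := by simp [homologyComplex]

theorem quasiIso_homologyComplexTo (K : HomologicalComplex (ModuleCat.{u} k) c) :
    QuasiIso (homologyComplexTo K) := by
  rw [quasiIso_iff]
  intro i
  rw [quasiIsoAt_iff_isIso_homologyMap]
  obtain ⟨σ, hσ, hσ'⟩ : ∃ σ : (homologyComplex K).X i ⟶ K.cycles i,
      (homologyComplexTo K).f i = σ ≫ K.iCycles i ∧ IsIso (σ ≫ K.homologyπ i) := by
    refine ⟨Projective.factorThru (P := K.homology i) (𝟙 _) (K.homologyπ i), rfl, ?_⟩
    have h := Projective.factorThru_comp (P := K.homology i) (𝟙 _) (K.homologyπ i)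
    exact (congrArg (fun f : K.homology i ⟶ K.homology i => IsIso f) h).mpr inferInstance
  have h1 : HomologicalComplex.cyclesMap (homologyComplexTo K) i =
      (homologyComplex K).iCycles i ≫ σ := by
    rw [← cancel_mono (K.iCycles i), HomologicalComplex.cyclesMap_i, hσ, Category.assoc]
  have : IsIso ((homologyComplex K).iCycles i) :=
    (homologyComplex K).isIso_iCycles i _ rfl rfl
  have : IsIso ((homologyComplex K).homologyπ i) :=
    (homologyComplex K).isIso_homologyπ _ i rfl rfl
  have h2 : (homologyComplex K).homologyπ i ≫
      HomologicalComplex.homologyMap (homologyComplexTo K) i =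
        (homologyComplex K).iCycles i ≫ σ ≫ K.homologyπ i := by
    rw [HomologicalComplex.homologyπ_naturality, h1, Category.assoc]
  rw [(IsIso.eq_inv_comp _).2 h2]
  infer_instance

/-- Over a field, complexes with isomorphic homology are isomorphic in the derived category, no
matter whether a chain map induces the isomorphisms. -/
theorem nonempty_toD_iso (K L : HomologicalComplex (ModuleCat.{u} k) c)
    (h : ∀ i, Nonempty (K.homology i ≅ L.homology i)) :
    Nonempty ((toD k c).obj K ≅ (toD k c).obj L) := by
  let e : homologyComplex K ≅ homologyComplex L :=
    HomologicalComplex.Hom.isoOfComponents (fun i => (h i).some)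
      (fun i j _ => by simp [homologyComplex])
  have hK := Localization.inverts (toD k c) (HomologicalComplex.quasiIso _ c)
    (homologyComplexTo K) (quasiIso_homologyComplexTo K)
  have hL := Localization.inverts (toD k c) (HomologicalComplex.quasiIso _ c)
    (homologyComplexTo L) (quasiIso_homologyComplexTo L)
  exact ⟨(asIso ((toD k c).map (homologyComplexTo K))).symm ≪≫ (toD k c).mapIso e ≪≫
    asIso ((toD k c).map (homologyComplexTo L))⟩

/-- Tensoring with a vector space is exact, so it commutes with homology. -/
theorem nonempty_homology_tensorComplex_iso (K : HomologicalComplex (ModuleCat.{u} k) c)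
    (V : ModuleCat.{u} k) (i : ι) :
    Nonempty ((tensorComplex K V).homology i ≅
      (MonoidalCategory.tensorRight V).obj (K.homology i)) := by
  exact ⟨(K.sc i).mapHomologyIso (MonoidalCategory.tensorRight V)⟩

theorem nonempty_toD_iso_tensor (K L : HomologicalComplex (ModuleCat.{u} k) c)
    (V : ModuleCat.{u} k) (P : ι → Prop)
    (hK : ∀ i, P i → Nonempty (K.homology i ≅ V))
    (hK0 : ∀ i, ¬ P i → Limits.IsZero (K.homology i))
    (hL : ∀ i, P i → Nonempty (L.homology i ≅ ModuleCat.of k k))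
    (hL0 : ∀ i, ¬ P i → Limits.IsZero (L.homology i)) :
    Nonempty ((toD k c).obj K ≅ (toD k c).obj (tensorComplex L V)) := by
  refine nonempty_toD_iso _ _ fun i => ?_
  obtain ⟨e⟩ := nonempty_homology_tensorComplex_iso L V i
  by_cases hi : P i
  · obtain ⟨e₁⟩ := hK i hi
    obtain ⟨e₂⟩ := hL i hi
    exact ⟨e₁ ≪≫ (TensorProduct.lid k V).symm.toModuleIso ≪≫
      (MonoidalCategory.tensorRight V).mapIso e₂.symm ≪≫ e.symm⟩
  · exact ⟨(hK0 i hi).iso (((MonoidalCategory.tensorRight V).map_isZero (hL0 i hi)).of_iso e)⟩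

end Homology

end CyclicHomology

/-! ### Total complexes of resolutions by mixed complexes -/

namespace CyclicHomology

namespace MixedComplex

variable {k : Type u} [Field k] (M : MixedComplex k)

/-- `M` resolves `V` through `π : M₀ → V`: the complex `⋯ → M₁ → M₀ → V → 0` is exact, and `M`
vanishes in negative degrees. -/
structure Resolves (V : Type u) [AddCommGroup V] [Module k V] (π : M.cx.X 0 →ₗ[k] V) :
    Prop where
  subsingleton : ∀ i < 0, Subsingleton (M.cx.X i)
  exact : ∀ a b c : ℤ, a + 1 = b → b + 1 = c → 0 < b → ∀ x : M.cx.X b,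
    (M.cx.d b a).hom x = 0 → ∃ y : M.cx.X c, (M.cx.d c b).hom y = x
  surjective : Function.Surjective π
  map_eq_zero_iff : ∀ x, π x = 0 ↔ ∃ y : M.cx.X 1, (M.cx.d 1 0).hom y = x

theorem anticomm_apply' {a b c : ℤ} (hab : a + 1 = b) (hbc : b + 1 = c) (y : M.cx.X b) :
    (M.cx.d c b).hom ((M.B b c).hom y) = -(M.B a b).hom ((M.cx.d b a).hom y) := by
  subst hbc
  obtain rfl : a = b - 1 := by omega
  exact eq_neg_of_add_eq_zero_left (M.anticomm_apply b y)

/-- The family solving `b w + B w = z` degree by degree on `P`, where `s` chooses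
preimages under `b`. -/
noncomputable def primitive (P : Set ℤ) [DecidablePred (· ∈ P)]
    (s : ∀ b c : ℤ, M.cx.X b → M.cx.X c) (z : ∀ m, M.cx.X m) : ∀ m, M.cx.X m
  | m => if _h : 0 < m ∧ m - 1 ∈ P then
      s (m - 1) m (z (m - 1) - (M.B (m - 2) (m - 1)).hom (primitive P s z (m - 2))) else 0
termination_by m => m.toNat
decreasing_by omega

theorem primitive_eq_zero (P : Set ℤ) [DecidablePred (· ∈ P)]
    (s : ∀ b c : ℤ, M.cx.X b → M.cx.X c) (z : ∀ m, M.cx.X m) (m : ℤ)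
    (h : ¬ (0 < m ∧ m - 1 ∈ P)) : M.primitive P s z m = 0 := by
  rw [primitive, dif_neg h]

theorem primitive_eq (P : Set ℤ) [DecidablePred (· ∈ P)]
    (s : ∀ b c : ℤ, M.cx.X b → M.cx.X c) (z : ∀ m, M.cx.X m) {a b c : ℤ}
    (hab : a + 1 = b) (hbc : b + 1 = c) (hc : 0 < c) (hb : b ∈ P) :
    M.primitive P s z c = s b c (z b - (M.B a b).hom (M.primitive P s z a)) := by
  obtain rfl : a = c - 2 := by omega
  obtain rfl : b = c - 1 := by omega
  rw [primitive, dif_pos ⟨hc, hb⟩]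

variable {M} {V : Type u} [AddCommGroup V] [Module k V] {π : M.cx.X 0 →ₗ[k] V}

/-- A family `z` supported on `P` with `b z + B z = 0` in the degrees `P - 1` has a primitive `w`
supported on `P + 1`, provided that `z₀` is trivial in `V`. The value `w 0 = 0` is what keeps the
degree `0` component fixed when an element of `M₀` is corrected to a cycle. -/
theorem Resolves.exists_primitive (h : M.Resolves V π) (P : Set ℤ) (z : ∀ m, M.cx.X m)
    (hz : ∀ m ∉ P, z m = 0)
    (hz' : ∀ a b c : ℤ, a + 1 = b → b + 1 = c → c ∈ P →
      (M.cx.d c b).hom (z c) + (M.B a b).hom (z a) = 0)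
    (h0 : π (z 0) = 0) :
    ∃ w : ∀ m, M.cx.X m, (∀ a b, a + 1 = b → a ∉ P → w b = 0) ∧ w 0 = 0 ∧
      ∀ a b c : ℤ, a + 1 = b → b + 1 = c → b ∈ P →
        (M.cx.d c b).hom (w c) + (M.B a b).hom (w a) = z b := by
  classical
  let s : ∀ b c : ℤ, M.cx.X b → M.cx.X c := fun b c y =>
    if H : ∃ x, (M.cx.d c b).hom x = y then H.choose else 0
  have hs : ∀ (b c : ℤ) (y : M.cx.X b), (∃ x, (M.cx.d c b).hom x = y) →
      (M.cx.d c b).hom (s b c y) = y := fun b c y H => by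
    simp only [s, dif_pos H]
    exact H.choose_spec
  refine ⟨M.primitive P s z, fun a b hab ha => ?_, ?_, ?_⟩
  · apply primitive_eq_zero
    rintro ⟨-, h'⟩
    exact ha (by convert h'; omega)
  · apply primitive_eq_zero
    simp
  · intro a b c hab hbc hb
    induction hn : c.toNat using Nat.strong_induction_on generalizing a b c with
    | _ n ih =>
    by_cases hc : 0 < c
    · rw [M.primitive_eq P s z hab hbc hc hb, hs, sub_add_cancel]
      by_cases hb0 : 0 < b
      · refine h.exact a b c hab hbc hb0 _ ?_
        obtain ⟨e, he⟩ : ∃ e, e + 1 = a := ⟨a - 1, by omega⟩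
        rw [map_sub, M.anticomm_apply' he hab, sub_neg_eq_add, ← hz' e a b he hab hb]
        congr 1
        -- Reduce `b (B wₐ) = -B (b wₐ)` to `-B zₑ`, by the equation in degree `e = b - 2`.
        by_cases heP : e ∈ P
        · obtain ⟨f, hf⟩ : ∃ f, f + 1 = e := ⟨e - 1, by omega⟩
          have := ih a.toNat (by omega) f e a hf he heP rfl
          rw [← this, map_add, B_B_apply, add_zero]
        · rw [hz e heP, M.primitive_eq_zero, map_zero]
          rintro ⟨-, h'⟩
          exact heP (by convert h'; omega)
      · obtain rfl : b = 0 := by omega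
        obtain rfl : c = 1 := by omega
        have := h.subsingleton a (by omega)
        rw [Subsingleton.elim (M.primitive P s z a) 0, map_zero, sub_zero]
        exact (h.map_eq_zero_iff _).1 h0
    · have := h.subsingleton b (by omega)
      exact Subsingleton.elim _ _

/-- `ev` identifies `E` with the families `(xₘ)` of elements of `Mₘ` supported on `P`. -/
structure IsFamilies (M : MixedComplex k) (P : Set ℤ) {E : Type u} [AddCommGroup E] [Module k E]
    (ev : E →ₗ[k] ∀ m, M.cx.X m) : Prop where
  injective : Function.Injective ev
  support : ∀ x, ∀ m ∉ P, ev x m = 0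
  exists_eq : ∀ w : ∀ m, M.cx.X m, (∀ m ∉ P, w m = 0) → ∃ x, ev x = w

/-- The linear map `f` is given by `b + B` on families, where values outside `Q` are dropped. -/
def IsTotalDifferential (M : MixedComplex k) (Q : Set ℤ) {E F : Type u} [AddCommGroup E]
    [Module k E] [AddCommGroup F] [Module k F] (ev : E →ₗ[k] ∀ m, M.cx.X m)
    (ev' : F →ₗ[k] ∀ m, M.cx.X m) (f : E →ₗ[k] F) : Prop :=
  ∀ x, ∀ a b c : ℤ, a + 1 = b → b + 1 = c → b ∈ Q →
    ev' (f x) b = (M.cx.d c b).hom (ev x c) + (M.B a b).hom (ev x a)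

section

variable {ι : Type} {c : ComplexShape ι} (K : HomologicalComplex (ModuleCat.{u} k) c) {i j l : ι}
  (hij : c.Rel i j) (hjl : c.Rel j l) {P Q R : Set ℤ} (hPQ : ∀ a b, a + 1 = b → (b ∈ P ↔ a ∈ Q))
  (hQR : ∀ a b, a + 1 = b → (b ∈ Q ↔ a ∈ R))
  {evP : K.X i →ₗ[k] ∀ m, M.cx.X m} {evQ : K.X j →ₗ[k] ∀ m, M.cx.X m}
  {evR : K.X l →ₗ[k] ∀ m, M.cx.X m}
  (hP : M.IsFamilies P evP) (hQ : M.IsFamilies Q evQ) (hR : M.IsFamilies R evR)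
  (hd : M.IsTotalDifferential Q evP evQ (K.d i j).hom)
  (hd' : M.IsTotalDifferential R evQ evR (K.d j l).hom)

include hPQ hQR hP hQ hd hd' in
/-- A cycle whose component in degree `0` vanishes in `V` is a boundary. -/
theorem Resolves.exists_d_eq (h : M.Resolves V π) (x : K.X j) (hx : (K.d j l).hom x = 0)
    (hx0 : π (evQ x 0) = 0) : ∃ y : K.X i, (K.d i j).hom y = x := by
  obtain ⟨w, hw, -, hw'⟩ := h.exists_primitive Q (evQ x) (hQ.support x) (fun a b c hab hbc hc => by
    rw [← hd' x a b c hab hbc ((hQR b c hbc).1 hc), hx, map_zero]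
    rfl) hx0
  obtain ⟨y, rfl⟩ := hP.exists_eq w fun m hm =>
    hw (m - 1) m (by omega) fun h' => hm ((hPQ _ _ (by omega)).2 h')
  refine ⟨y, hQ.injective (funext fun m => ?_)⟩
  by_cases hm : m ∈ Q
  · rw [hd y (m - 1) m (m + 1) (by omega) rfl hm, hw' _ _ _ (by omega) rfl hm]
  · rw [hQ.support _ m hm, hQ.support _ m hm]

include hij hjl hPQ hQR hP hQ hd hd' in
/-- Three consecutive terms `P → Q → R` of a total complex have no homology if degree `0` does not
occur in `Q`. -/
theorem Resolves.isZero_homology (h : M.Resolves V π) (h0 : 0 ∉ Q) :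
    Limits.IsZero (K.homology j) :=
  CyclicHomology.isZero_homology K hij hjl fun x hx =>
    h.exists_d_eq K hPQ hQR hP hQ hd hd' x hx (by rw [hQ.support x 0 h0, map_zero])

include hij hjl hPQ hQR hP hQ hR hd hd' in
/-- Three consecutive terms `P → Q → R` of a total complex have homology `V` if degree `0` occurs in
`Q`; the isomorphism takes the component in degree `0`. -/
theorem Resolves.nonempty_homology_iso (h : M.Resolves V π) (h0 : 0 ∈ Q) :
    Nonempty (K.homology j ≅ ModuleCat.of k V) := by
  have h1 := h.subsingleton (-1) (by omega)
  refine CyclicHomology.nonempty_homology_iso K hij hjl (ModuleCat.of k V)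
    (π ∘ₗ LinearMap.proj 0 ∘ₗ evQ) (fun y => ?_)
    (fun x hx hx0 => h.exists_d_eq K hPQ hQR hP hQ hd hd' x hx hx0) fun v => ?_
  · change π (evQ ((K.d i j).hom y) 0) = 0
    rw [hd y (-1) 0 1 rfl rfl h0, Subsingleton.elim (evP y (-1)) 0, map_zero, add_zero]
    exact (h.map_eq_zero_iff _).2 ⟨_, rfl⟩
  · obtain ⟨v, rfl⟩ := h.surjective v
    classical
    have hdB : ∀ b c, b + 1 = c → (M.cx.d c b).hom ((M.B 0 c).hom v) = 0 := fun b c hbc => by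
      by_cases hc : 0 + 1 = c
      · obtain rfl : b = 0 := by omega
        rw [M.anticomm_apply' (a := -1) (by omega) hbc,
          Subsingleton.elim ((M.cx.d 0 (-1)).hom v) 0, map_zero, neg_zero]
      · rw [M.B_shape 0 c hc]
        exact map_zero _
    -- A primitive `w` of `B v`, supported on `Q` and zero in degree `0`, turns `v` into the cycle
    -- `v - w`. If the degree of `B v` lies outside `R`, the family below is `0`.
    obtain ⟨w, hw, hw0, hw'⟩ := h.exists_primitive R
      (fun m => if m ∈ R then (M.B 0 m).hom v else 0) (fun m hm => if_neg hm)
      (fun a b c hab hbc hc => by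
        rw [if_pos hc, hdB b c hbc, zero_add]
        split_ifs
        · rw [B_B_apply]
        · rw [map_zero])
      (by
        split_ifs
        · rw [M.B_shape 0 0 (by omega)]
          exact map_zero _
        · exact map_zero _)
    obtain ⟨x, hx⟩ := hQ.exists_eq (Pi.single 0 v - w) fun m hm => by
      rw [Pi.sub_apply, hw (m - 1) m (by omega) fun h' => hm ((hQR _ _ (by omega)).2 h'),
        Pi.single_eq_of_ne (by rintro rfl; exact hm h0), sub_zero]
    refine ⟨x, hR.injective (funext fun m => ?_), ?_⟩
    · rw [map_zero, Pi.zero_apply]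
      by_cases hm : m ∈ R
      · rw [hd' x (m - 1) m (m + 1) (by omega) rfl hm, hx, Pi.sub_apply, Pi.sub_apply, map_sub,
          map_sub, sub_add_sub_comm, hw' _ _ _ (by omega) rfl hm, if_pos hm, sub_eq_zero]
        have e1 : (M.cx.d (m + 1) m).hom (Pi.single (M := fun m => M.cx.X m) 0 v (m + 1)) = 0 := by
          by_cases hm' : m + 1 = 0
          · have := h.subsingleton m (by omega)
            exact Subsingleton.elim _ _
          · rw [Pi.single_eq_of_ne hm', map_zero]
        rw [e1, zero_add]
        by_cases hm' : m = 1
        · subst hm'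
          exact congrArg _ (Pi.single_eq_same (M := fun m : ℤ => M.cx.X m) 0 v)
        · rw [Pi.single_eq_of_ne (by omega), map_zero, M.B_shape 0 m (by omega)]
          rfl
      · exact hR.support _ m hm
    · change π (evQ x 0) = π v
      rw [hx, Pi.sub_apply, hw0, Pi.single_eq_same, sub_zero]

end

end MixedComplex

end CyclicHomology

/-! ### Cyclic, negative cyclic and periodic cyclic homology of a resolution -/

namespace CyclicHomology

namespace MixedComplex

variable {k : Type u} [Field k] (M : MixedComplex k)

/-- The family, indexed by all of `ℤ`, underlying an element of a product over `P`. -/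
noncomputable def prodFamily (P : Set ℤ) [DecidablePred (· ∈ P)] :
    (∀ m : P, M.cx.X m) →ₗ[k] ∀ m, M.cx.X m :=
  LinearMap.pi fun m => M.prodComponent P m

theorem isFamilies_prodFamily (P : Set ℤ) [DecidablePred (· ∈ P)] :
    M.IsFamilies P (M.prodFamily P) where
  injective x y h := funext fun ⟨m, hm⟩ => by
    have := congrFun h m
    simpa [prodFamily, prodComponent, hm] using this
  support x m hm := M.prodComponent_of_notMem P m hm x
  exists_eq w hw := ⟨fun m => w m, funext fun m => by
    by_cases hm : m ∈ P
    · simp [prodFamily, prodComponent, hm]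
    · simp [prodFamily, prodComponent, hm, hw m hm]⟩

theorem isTotalDifferential_prodMap (P Q : Set ℤ) [DecidablePred (· ∈ P)]
    [DecidablePred (· ∈ Q)] :
    M.IsTotalDifferential Q (M.prodFamily P) (M.prodFamily Q) (M.prodMap P Q) := by
  intro x a b c hab hbc hb
  subst hbc
  obtain rfl : a = b - 1 := by omega
  exact M.prodComponent_prodMap P Q b hb x

/-- The family, indexed by all of `ℤ`, underlying an element of a direct sum over `P`. -/
noncomputable def sumFamily (P : Set ℤ) [DecidablePred (· ∈ P)] :
    (DirectSum P fun m => M.cx.X m) →ₗ[k] ∀ m, M.cx.X m :=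
  M.prodFamily P ∘ₗ DirectSum.coeFnLinearMap k

theorem sumFamily_sumIncl (P : Set ℤ) [DecidablePred (· ∈ P)] {i : ℤ} (hi : i ∈ P)
    (y : M.cx.X i) : M.sumFamily P (M.sumIncl P i y) = Pi.single i y := by
  funext m
  rw [sumIncl, dif_pos hi]
  by_cases hm : m ∈ P
  · have : M.sumFamily P (DirectSum.lof k P (fun m => M.cx.X m) ⟨i, hi⟩ y) m =
        (DirectSum.lof k P (fun m => M.cx.X m) ⟨i, hi⟩ y) ⟨m, hm⟩ := by
      simp [sumFamily, prodFamily, prodComponent, hm]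
    rw [this]
    by_cases h : m = i
    · subst h
      rw [DirectSum.lof_apply, Pi.single_eq_same]
    · rw [Pi.single_eq_of_ne h]
      exact DirectSum.of_eq_of_ne _ _ _ (by simpa using h)
  · rw [Pi.single_eq_of_ne (by rintro rfl; exact hm hi)]
    exact M.prodComponent_of_notMem P m hm _

theorem sumFamily_sumIncl_apply (P : Set ℤ) [DecidablePred (· ∈ P)] {i m : ℤ} (hm : m ∈ P)
    (y : M.cx.X i) : M.sumFamily P (M.sumIncl P i y) m =
      Pi.single (M := fun m => M.cx.X m) i y m := by
  by_cases hi : i ∈ P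
  · rw [M.sumFamily_sumIncl P hi]
  · rw [M.sumIncl_of_notMem P i hi, map_zero, Pi.single_eq_of_ne (by rintro rfl; exact hi hm)]
    rfl

/-- In a mixed complex that vanishes in negative degrees, the families supported on a set that is
bounded above have finite support, hence come from the direct sum. -/
theorem isFamilies_sumFamily (h : ∀ i < 0, Subsingleton (M.cx.X i)) (P : Set ℤ)
    [DecidablePred (· ∈ P)] (n : ℤ) (hP : ∀ m ∈ P, m ≤ n) :
    M.IsFamilies P (M.sumFamily P) where
  injective := (M.isFamilies_prodFamily P).injective.comp DFunLike.coe_injective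
  support x := (M.isFamilies_prodFamily P).support _
  exists_eq w hw := by
    classical
    refine ⟨∑ i ∈ Finset.Icc 0 n, M.sumIncl P i (w i), funext fun m => ?_⟩
    by_cases hm : m ∈ P
    · by_cases h0 : m < 0
      · have := h m h0
        exact Subsingleton.elim _ _
      · rw [map_sum, Finset.sum_apply, Finset.sum_eq_single m]
        · rw [M.sumFamily_sumIncl P hm, Pi.single_eq_same]
        · intro i _ hi
          rw [M.sumFamily_sumIncl_apply P hm, Pi.single_eq_of_ne hi.symm]
        · intro hi
          exact absurd (Finset.mem_Icc.2 ⟨by omega, hP m hm⟩) hi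
    · rw [hw m hm]
      exact (M.isFamilies_prodFamily P).support _ m hm

theorem isTotalDifferential_sumMap (P Q : Set ℤ) [DecidablePred (· ∈ P)]
    [DecidablePred (· ∈ Q)] :
    M.IsTotalDifferential Q (M.sumFamily P) (M.sumFamily Q) (M.sumMap P Q) := by
  intro x a b c hab hbc hb
  induction x using DirectSum.induction_on with
  | zero => simp
  | add x y hx hy =>
    simp only [map_add, Pi.add_apply] at hx hy ⊢
    rw [hx, hy]
    abel
  | of i y =>
    obtain ⟨i, hi⟩ := i
    have e : DirectSum.of (fun m : P => M.cx.X m) ⟨i, hi⟩ y = M.sumIncl P i y := by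
      rw [sumIncl, dif_pos hi]
      rfl
    rw [e, M.sumMap_sumIncl P Q i hi, M.sumFamily_sumIncl P hi, map_add, Pi.add_apply,
      M.sumFamily_sumIncl_apply Q hb, M.sumFamily_sumIncl_apply Q hb]
    congr 1
    · by_cases hc : c = i
      · subst hc
        obtain rfl : b = c - 1 := by omega
        rw [Pi.single_eq_same, Pi.single_eq_same]
      · rw [Pi.single_eq_of_ne (by omega), Pi.single_eq_of_ne hc, map_zero]
    · by_cases ha : a = i
      · subst ha hab
        rw [Pi.single_eq_same, Pi.single_eq_same]
      · rw [Pi.single_eq_of_ne (by omega), Pi.single_eq_of_ne ha, map_zero]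

variable {M} {V : Type u} [AddCommGroup V] [Module k V] {π : M.cx.X 0 →ₗ[k] V}

theorem negative_isTotalDifferential (n l : ℤ) (h : l + 1 = n) :
    M.IsTotalDifferential {m : ℤ | l ≤ m ∧ Even (m - l)} (M.prodFamily _) (M.prodFamily _)
      (M.negative.d n l).hom := by
  have : M.negative.d n l = ModuleCat.ofHom (M.prodMap _ _) := if_pos h
  rw [this]
  exact M.isTotalDifferential_prodMap _ _

theorem periodic_isTotalDifferential (n l : ZMod 2) (h : l + 1 = n) :
    M.IsTotalDifferential {m : ℤ | (m : ZMod 2) = l} (M.prodFamily _) (M.prodFamily _)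
      (M.periodic.d n l).hom := by
  have : M.periodic.d n l = ModuleCat.ofHom (M.prodMap _ _) := if_pos h
  rw [this]
  exact M.isTotalDifferential_prodMap _ _

theorem cyclic_isTotalDifferential (n l : ℤ) (h : l + 1 = n) :
    M.IsTotalDifferential {m : ℤ | m ≤ l ∧ Even (l - m)} (M.sumFamily _) (M.sumFamily _)
      (M.cyclic.d n l).hom := by
  have : M.cyclic.d n l = ModuleCat.ofHom (M.sumMap _ _) := if_pos h
  rw [this]
  exact M.isTotalDifferential_sumMap _ _

theorem Resolves.negative (h : M.Resolves V π) (j : ℤ) :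
    (j ≤ 0 ∧ Even j → Nonempty (M.negative.homology j ≅ ModuleCat.of k V)) ∧
    (¬ (j ≤ 0 ∧ Even j) → Limits.IsZero (M.negative.homology j)) := by
  have shift : ∀ n a b : ℤ, a + 1 = b →
      (b ∈ {m : ℤ | n + 1 ≤ m ∧ Even (m - (n + 1))} ↔ a ∈ {m : ℤ | n ≤ m ∧ Even (m - n)}) := by
    rintro n a b rfl
    simp
  obtain ⟨l, rfl⟩ : ∃ l, j = l + 1 := ⟨j - 1, by omega⟩
  have mem : (0 : ℤ) ∈ {m : ℤ | l + 1 ≤ m ∧ Even (m - (l + 1))} ↔ l + 1 ≤ 0 ∧ Even (l + 1) := by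
    rw [Set.mem_ofPred_eq, zero_sub, even_neg]
  refine ⟨fun hj => ?_, fun hj => ?_⟩
  · exact h.nonempty_homology_iso M.negative (i := l + 1 + 1) (j := l + 1) (l := l) rfl rfl
      (shift _) (shift _)
      (M.isFamilies_prodFamily _) (M.isFamilies_prodFamily _) (M.isFamilies_prodFamily _)
      (negative_isTotalDifferential _ _ rfl) (negative_isTotalDifferential _ _ rfl) (mem.2 hj)
  · exact h.isZero_homology M.negative (i := l + 1 + 1) (j := l + 1) (l := l) rfl rfl
      (shift _) (shift _)
      (M.isFamilies_prodFamily _) (M.isFamilies_prodFamily _)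
      (negative_isTotalDifferential _ _ rfl) (negative_isTotalDifferential _ _ rfl)
      (fun h' => hj (mem.1 h'))

theorem Resolves.cyclic (h : M.Resolves V π) (j : ℤ) :
    (0 ≤ j ∧ Even j → Nonempty (M.cyclic.homology j ≅ ModuleCat.of k V)) ∧
    (¬ (0 ≤ j ∧ Even j) → Limits.IsZero (M.cyclic.homology j)) := by
  have shift : ∀ n a b : ℤ, a + 1 = b →
      (b ∈ {m : ℤ | m ≤ n + 1 ∧ Even (n + 1 - m)} ↔ a ∈ {m : ℤ | m ≤ n ∧ Even (n - m)}) := by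
    rintro n a b rfl
    simp
  have fam : ∀ n : ℤ, M.IsFamilies {m : ℤ | m ≤ n ∧ Even (n - m)} (M.sumFamily _) := fun n =>
    M.isFamilies_sumFamily h.subsingleton _ n fun m hm => hm.1
  obtain ⟨l, rfl⟩ : ∃ l, j = l + 1 := ⟨j - 1, by omega⟩
  have mem : (0 : ℤ) ∈ {m : ℤ | m ≤ l + 1 ∧ Even (l + 1 - m)} ↔ 0 ≤ l + 1 ∧ Even (l + 1) := by
    rw [Set.mem_ofPred_eq, sub_zero]
  refine ⟨fun hj => ?_, fun hj => ?_⟩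
  · exact h.nonempty_homology_iso M.cyclic (i := l + 1 + 1) (j := l + 1) (l := l) rfl rfl
      (shift _) (shift _) (fam _) (fam _) (fam _)
      (cyclic_isTotalDifferential _ _ rfl) (cyclic_isTotalDifferential _ _ rfl) (mem.2 hj)
  · exact h.isZero_homology M.cyclic (i := l + 1 + 1) (j := l + 1) (l := l) rfl rfl
      (shift _) (shift _) (fam _) (fam _)
      (cyclic_isTotalDifferential _ _ rfl) (cyclic_isTotalDifferential _ _ rfl)
      (fun h' => hj (mem.1 h'))

theorem Resolves.periodic (h : M.Resolves V π) (p : ZMod 2) :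
    (p = 0 → Nonempty (M.periodic.homology p ≅ ModuleCat.of k V)) ∧
    (p ≠ 0 → Limits.IsZero (M.periodic.homology p)) := by
  have shift : ∀ (p : ZMod 2) (a b : ℤ), a + 1 = b →
      (b ∈ {m : ℤ | (m : ZMod 2) = p + 1} ↔ a ∈ {m : ℤ | (m : ZMod 2) = p}) := by
    rintro p a b rfl
    simp
  obtain ⟨l, rfl⟩ : ∃ l, p = l + 1 := ⟨p - 1, by ring⟩
  have mem : (0 : ℤ) ∈ {m : ℤ | (m : ZMod 2) = l + 1} ↔ l + 1 = 0 := by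
    rw [Set.mem_ofPred_eq, Int.cast_zero, eq_comm]
  refine ⟨fun hj => ?_, fun hj => ?_⟩
  · exact h.nonempty_homology_iso M.periodic (i := l + 1 + 1) (j := l + 1) (l := l) rfl rfl
      (shift _) (shift _)
      (M.isFamilies_prodFamily _) (M.isFamilies_prodFamily _) (M.isFamilies_prodFamily _)
      (periodic_isTotalDifferential _ _ rfl) (periodic_isTotalDifferential _ _ rfl) (mem.2 hj)
  · exact h.isZero_homology M.periodic (i := l + 1 + 1) (j := l + 1) (l := l) rfl rfl
      (shift _) (shift _)
      (M.isFamilies_prodFamily _) (M.isFamilies_prodFamily _)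
      (periodic_isTotalDifferential _ _ rfl) (periodic_isTotalDifferential _ _ rfl)
      (fun h' => hj (mem.1 h'))

theorem Resolves.cx (h : M.Resolves V π) (j : ℤ) :
    (j = 0 → Nonempty (M.cx.homology j ≅ ModuleCat.of k V)) ∧
    (j ≠ 0 → Limits.IsZero (M.cx.homology j)) := by
  refine ⟨?_, fun hj => ?_⟩
  · rintro rfl
    have := h.subsingleton (-1) (by omega)
    exact CyclicHomology.nonempty_homology_iso M.cx (i := 1) (j := 0) (l := -1) rfl
      (neg_add_cancel (1 : ℤ)) _ π
      (fun y => (h.map_eq_zero_iff _).2 ⟨y, rfl⟩) (fun x _ hx => (h.map_eq_zero_iff _).1 hx)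
      (fun v => (h.surjective v).imp fun x hx => ⟨Subsingleton.elim _ _, hx⟩)
  · refine CyclicHomology.isZero_homology M.cx (i := j + 1) (j := j) (l := j - 1) rfl
      (sub_add_cancel j 1) fun x hx => ?_
    by_cases h0 : 0 < j
    · exact h.exact (j - 1) j (j + 1) (by omega) rfl h0 x hx
    · have := h.subsingleton j (by omega)
      exact ⟨0, Subsingleton.elim _ _⟩

end MixedComplex

end CyclicHomology

/-! ### The contraction of the Hochschild complex of a separable algebra -/

namespace CyclicHomology

section Separable

variable (k A : Type u) [Field k] [Ring A] [Algebra k A]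

/-- A separability idempotent: an element `e = ∑ xᵢ ⊗ yᵢ` of `A ⊗ A` with `∑ xᵢ yᵢ = 1` and
`∑ a xᵢ ⊗ yᵢ = ∑ xᵢ ⊗ yᵢ a` for all `a`. -/
structure IsSeparabilityIdempotent (e : A ⊗[k] A) : Prop where
  mul_eq_one : LinearMap.mul' k A e = 1
  comm : ∀ a : A, (LinearMap.mulLeft k a).rTensor A e = (LinearMap.mulRight k a).lTensor A e

/-- The image of `1` under a bimodule section of the multiplication `A ⊗ Aᵐᵒᵖ → A`. -/
theorem IsSeparableAlgebra.exists_idempotent (hA : IsSeparableAlgebra k A) :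
    ∃ e : A ⊗[k] A, IsSeparabilityIdempotent k A e := by
  let _ : Module (A ⊗[k] Aᵐᵒᵖ) A := TensorProduct.Algebra.module
  have : Module.Projective (A ⊗[k] Aᵐᵒᵖ) A := hA
  let μ : A ⊗[k] Aᵐᵒᵖ →ₗ[A ⊗[k] Aᵐᵒᵖ] A := LinearMap.toSpanSingleton _ _ 1
  have smul_one (a : A) (b : Aᵐᵒᵖ) : (a ⊗ₜ[k] b) • (1 : A) = a * b.unop := by
    rw [TensorProduct.Algebra.smul_def]
    simp
  have hμ : Function.Surjective μ := fun a => ⟨a ⊗ₜ 1, by simp [μ, smul_one]⟩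
  obtain ⟨s, hs⟩ := Module.projective_lifting_property μ LinearMap.id hμ
  let τ : A ⊗[k] Aᵐᵒᵖ →ₗ[k] A ⊗[k] A :=
    ((MulOpposite.opLinearEquiv k (M := A)).symm : Aᵐᵒᵖ →ₗ[k] A).lTensor A
  have h1 : ∀ x, LinearMap.mul' k A (τ x) = μ x := fun x => by
    induction x with
    | zero => simp
    | tmul a b => simp [τ, μ, smul_one]
    | add x y hx hy => simp [hx, hy]
  have h2 : ∀ a x, (LinearMap.mulLeft k a).rTensor A (τ x) = τ ((a ⊗ₜ 1) * x) := fun a x => by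
    induction x with
    | zero => simp
    | tmul a b => simp [τ]
    | add x y hx hy => simp [hx, hy, mul_add]
  have h3 : ∀ a x, (LinearMap.mulRight k a).lTensor A (τ x) =
      τ ((1 ⊗ₜ MulOpposite.op a) * x) := fun a x => by
    induction x with
    | zero => simp
    | tmul a b => simp [τ]
    | add x y hx hy => simp [hx, hy, mul_add]
  refine ⟨τ (s 1), (h1 _).trans (LinearMap.congr_fun hs 1), fun a => ?_⟩
  rw [h2, h3, ← smul_eq_mul, ← smul_eq_mul, ← map_smul, ← map_smul, smul_one, smul_one]
  simp

theorem isSeparabilityIdempotent_one : IsSeparabilityIdempotent k k (1 ⊗ₜ 1) where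
  mul_eq_one := by simp
  comm a := by
    simp only [LinearMap.rTensor_tmul, LinearMap.lTensor_tmul, LinearMap.mulLeft_apply,
      LinearMap.mulRight_apply, mul_one, one_mul]
    rw [← mul_one a, ← smul_eq_mul, TensorProduct.smul_tmul]

variable {A}

/-- The map `x ⊗ y ↦ a₀x ⊗ y ⊗ a₁ ⊗ ⋯ ⊗ aₙ`, where `t = (a₁, …, aₙ)`. -/
noncomputable def insertTensor {n : ℕ} (a₀ : A) (t : Fin n → A) : A ⊗[k] A →ₗ[k] TPow k A (n + 1) :=
  TensorProduct.lift (LinearMap.mk₂ k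
    (fun x y => PiTensorProduct.tprod k (Fin.cons (a₀ * x) (Fin.cons y t) : Fin (n + 2) → A))
    (fun x x' y => by rw [mul_add, MultilinearMap.cons_add])
    (fun c x y => by rw [mul_smul_comm, MultilinearMap.cons_smul])
    (fun x y y' => by
      simpa using ((PiTensorProduct.tprod k (s := fun _ : Fin (n + 2) => A)).curryLeft
        (a₀ * x)).cons_add t y y')
    (fun c x y => by
      simpa using ((PiTensorProduct.tprod k (s := fun _ : Fin (n + 2) => A)).curryLeft
        (a₀ * x)).cons_smul t c y))

theorem insertTensor_tmul {n : ℕ} (a₀ : A) (t : Fin n → A) (x y : A) :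
    insertTensor k a₀ t (x ⊗ₜ y) =
      PiTensorProduct.tprod k (Fin.cons (a₀ * x) (Fin.cons y t) : Fin (n + 2) → A) :=
  rfl

/-- The map `a₀ ⊗ ⋯ ⊗ aₙ ↦ ∑ a₀xᵢ ⊗ yᵢ ⊗ a₁ ⊗ ⋯ ⊗ aₙ` for `e = ∑ xᵢ ⊗ yᵢ`; it contracts the
Hochschild complex in positive degrees if `e` is a separability idempotent. -/
noncomputable def insertion (e : A ⊗[k] A) (n : ℕ) : TPow k A n →ₗ[k] TPow k A (n + 1) :=
  PiTensorProduct.lift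
    { toFun := fun a => insertTensor k (a 0) (Fin.tail a) e
      map_update_add' := by
        intro inst a i x y
        obtain rfl : inst = instDecidableEqFin _ := Subsingleton.elim _ _
        induction e with
        | zero => simp
        | tmul u v =>
          simp only [insertTensor_tmul]
          rcases Fin.eq_zero_or_eq_succ i with rfl | ⟨i, rfl⟩
          · simp [add_mul, MultilinearMap.cons_add]
          · simp [Fin.tail_update_succ, Fin.cons_update,
              Function.update_of_ne (Fin.succ_ne_zero i).symm]
        | add e e' h h' =>
          simp only [map_add, h, h']
          abel
      map_update_smul' := by
        intro inst a i c x
        obtain rfl : inst = instDecidableEqFin _ := Subsingleton.elim _ _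
        induction e with
        | zero => simp
        | tmul u v =>
          simp only [insertTensor_tmul]
          rcases Fin.eq_zero_or_eq_succ i with rfl | ⟨i, rfl⟩
          · simp [MultilinearMap.cons_smul]
          · simp [Fin.tail_update_succ, Fin.cons_update,
              Function.update_of_ne (Fin.succ_ne_zero i).symm]
        | add e e' h h' => simp only [map_add, h, h', smul_add] }

theorem insertion_tprod (e : A ⊗[k] A) {n : ℕ} (a : Fin (n + 1) → A) :
    insertion k e n (PiTensorProduct.tprod k a) = insertTensor k (a 0) (Fin.tail a) e :=
  PiTensorProduct.lift.tprod _

theorem contract_zero_insertTensor {n : ℕ} (a₀ : A) (t : Fin n → A) (e : A ⊗[k] A) :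
    contract k A 0 (insertTensor k a₀ t e) =
      PiTensorProduct.tprod k (Fin.cons (a₀ * LinearMap.mul' k A e) t : Fin (n + 1) → A) := by
  induction e with
  | zero =>
    simp only [map_zero, mul_zero]
    exact (MultilinearMap.map_coord_zero _ 0 rfl).symm
  | tmul x y =>
    rw [insertTensor_tmul, contract_tprod]
    refine congrArg _ (funext fun l => ?_)
    rcases Fin.eq_zero_or_eq_succ l with rfl | ⟨l, rfl⟩ <;> simp [Fin.contractNth, mul_assoc]
  | add e e' h h' => rw [map_add, map_add, h, h', map_add, mul_add, MultilinearMap.cons_add]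

theorem contract_one_insertTensor {n : ℕ} (a₀ : A) (t : Fin (n + 1) → A) (e : A ⊗[k] A) :
    contract k A 1 (insertTensor k a₀ t e) =
      insertTensor k a₀ (Fin.tail t) ((LinearMap.mulRight k (t 0)).lTensor A e) := by
  induction e with
  | zero => simp
  | tmul x y =>
    rw [insertTensor_tmul, contract_tprod, LinearMap.lTensor_tmul, insertTensor_tmul]
    refine congrArg _ (funext fun l => ?_)
    rcases Fin.eq_zero_or_eq_succ l with rfl | ⟨l, rfl⟩
    · simp [Fin.contractNth]
    · rcases Fin.eq_zero_or_eq_succ l with rfl | ⟨l, rfl⟩ 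
      · exact congrArg (y * ·) (Fin.cons_succ (α := fun _ => A) (a₀ * x) (Fin.cons y t) 1)
      · simp [Fin.contractNth, Fin.tail]
  | add e e' h h' => simp only [map_add, h, h']

theorem insertTensor_mul {n : ℕ} (a₀ b : A) (t : Fin n → A) (e : A ⊗[k] A) :
    insertTensor k (a₀ * b) t e =
      insertTensor k a₀ t ((LinearMap.mulLeft k b).rTensor A e) := by
  induction e with
  | zero => simp
  | tmul x y => simp [insertTensor_tmul, mul_assoc]
  | add e e' h h' => simp only [map_add, h, h']

theorem contract_succ_insertTensor {n : ℕ} (i : Fin n) (a₀ : A) (t : Fin (n + 1) → A)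
    (e : A ⊗[k] A) :
    contract k A i.succ.succ (insertTensor k a₀ t e) =
      insertTensor k a₀ (Fin.contractNth i.castSucc (· * ·) t) e := by
  induction e with
  | zero => simp
  | tmul x y =>
    rw [insertTensor_tmul, contract_tprod, insertTensor_tmul]
    refine congrArg _ (funext fun l => ?_)
    rcases Fin.eq_zero_or_eq_succ l with rfl | ⟨l, rfl⟩
    · simp [Fin.contractNth]
    · rcases Fin.eq_zero_or_eq_succ l with rfl | ⟨l, rfl⟩ <;> simp [Fin.contractNth]
  | add e e' h h' => simp only [map_add, h, h']

theorem face_last_tprod {n : ℕ} (a : Fin (n + 2) → A) :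
    face k A (Fin.last (n + 1)) (PiTensorProduct.tprod k a) =
      PiTensorProduct.tprod k
        (Fin.cons (a (Fin.last (n + 1)) * a 0) (Fin.tail (Fin.init a)) : Fin (n + 1) → A) := by
  rw [face_last, LinearMap.comp_apply, rot_tprod, contract_tprod]
  refine congrArg _ (funext fun l => ?_)
  rcases Fin.eq_zero_or_eq_succ l with rfl | ⟨l, rfl⟩
  · simp [Fin.contractNth]
    rfl
  · simp [Fin.contractNth, Fin.tail, Fin.init]
    rfl

theorem face_last_insertTensor {n : ℕ} (a₀ : A) (t : Fin (n + 1) → A) (e : A ⊗[k] A) :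
    face k A (Fin.last (n + 2)) (insertTensor k a₀ t e) =
      insertTensor k (t (Fin.last n) * a₀) (Fin.init t) e := by
  induction e with
  | zero => simp
  | tmul x y =>
    rw [insertTensor_tmul, face_last_tprod, insertTensor_tmul]
    refine congrArg _ (funext fun l => ?_)
    rcases Fin.eq_zero_or_eq_succ l with rfl | ⟨l, rfl⟩
    · simp [← Fin.succ_last, mul_assoc]
    · rcases Fin.eq_zero_or_eq_succ l with rfl | ⟨l, rfl⟩
      · simp [Fin.tail, Fin.init]
      · simp [Fin.tail, Fin.init]
  | add e e' h h' => simp only [map_add, h, h']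

variable {k} {e : A ⊗[k] A} (he : IsSeparabilityIdempotent k A e)
include he

theorem IsSeparabilityIdempotent.face_zero_insertion (n : ℕ) :
    face k A 0 ∘ₗ insertion k e n = LinearMap.id := by
  ext a
  simp only [LinearMap.compMultilinearMap_apply, LinearMap.comp_apply, insertion_tprod,
    LinearMap.id_apply]
  rw [← Fin.castSucc_zero, face_castSucc, contract_zero_insertTensor, he.mul_eq_one, mul_one,
    Fin.cons_self_tail]

theorem IsSeparabilityIdempotent.face_succ_insertion {n : ℕ} (i : Fin (n + 2)) :
    face k A i.succ ∘ₗ insertion k e (n + 1) = insertion k e n ∘ₗ face k A i := by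
  ext a
  simp only [LinearMap.compMultilinearMap_apply, LinearMap.comp_apply, insertion_tprod]
  induction i using Fin.lastCases with
  | last =>
    rw [Fin.succ_last, face_last_insertTensor, face_last_tprod, insertion_tprod, Fin.cons_zero,
      Fin.tail_cons]
    rfl
  | cast i =>
    rw [Fin.succ_castSucc, face_castSucc, face_castSucc, contract_tprod, insertion_tprod]
    rcases Fin.eq_zero_or_eq_succ i with rfl | ⟨i, rfl⟩
    · rw [Fin.succ_zero_eq_one, contract_one_insertTensor, ← he.comm, ← insertTensor_mul]
      rfl
    · rw [contract_succ_insertTensor]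
      have h0 : Fin.contractNth i.succ.castSucc (· * ·) a 0 = a 0 := by simp [Fin.contractNth]
      have h1 : Fin.tail (Fin.contractNth i.succ.castSucc (· * ·) a) =
          Fin.contractNth i.castSucc (· * ·) (Fin.tail a) := by
        funext l
        simp [Fin.contractNth, Fin.tail]
      rw [h0, h1]

/-- Since `d₀ h = 1` and `dᵢ₊₁ h = h dᵢ`, all the terms of `b h + h b` cancel except `d₀ h`. -/
theorem IsSeparabilityIdempotent.hochschildB_insertion (n : ℕ) :
    hochschildB k A (n + 1) ∘ₗ insertion k e (n + 1) + insertion k e n ∘ₗ hochschildB k A n =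
      LinearMap.id := by
  have h (i : Fin (n + 2)) : ((-1 : k) ^ (i.succ : ℕ) • face k A i.succ) ∘ₗ
      insertion k e (n + 1) = -(insertion k e n ∘ₗ ((-1 : k) ^ (i : ℕ) • face k A i)) := by
    rw [LinearMap.smul_comp, LinearMap.comp_smul, he.face_succ_insertion, Fin.val_succ, pow_succ,
      mul_neg_one]
    exact neg_smul ((-1 : k) ^ (i : ℕ)) (insertion k e n ∘ₗ face k A i)
  rw [hochschildB, Fin.sum_univ_succ, hochschildB, lcomp_sum, LinearMap.add_comp, sum_lcomp]
  simp only [h, Finset.sum_neg_distrib, neg_add_cancel_right]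
  simp [he.face_zero_insertion]

theorem IsSeparabilityIdempotent.exists_hochschildB_eq {n : ℕ} (x : TPow k A (n + 1))
    (hx : hochschildB k A n x = 0) : ∃ y, hochschildB k A (n + 1) y = x :=
  ⟨insertion k e (n + 1) x, by
    have := LinearMap.congr_fun (he.hochschildB_insertion n) x
    simpa [hx] using this⟩

end Separable

end CyclicHomology

/-! ### Resolutions in the derived category of mixed complexes -/

namespace CyclicHomology

namespace MixedComplex

variable {k : Type u} [Field k] {M : MixedComplex k} {V : Type u} [AddCommGroup V] [Module k V]
  {π : M.cx.X 0 →ₗ[k] V}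

theorem Resolves.postcomp (h : M.Resolves V π) {W : Type u} [AddCommGroup W] [Module k W]
    (e : V ≃ₗ[k] W) : M.Resolves W (e.toLinearMap ∘ₗ π) where
  subsingleton := h.subsingleton
  exact := h.exact
  surjective := e.surjective.comp h.surjective
  map_eq_zero_iff x := by
    rw [← h.map_eq_zero_iff]
    exact e.map_eq_zero_iff

/-- Exactness in positive degrees uses that `W` is flat, and in degree `0` that `⊗ W` is right
exact. -/
theorem Resolves.tensor (h : M.Resolves V π) (W : ModuleCat.{u} k) :
    (M.tensor W).Resolves (V ⊗[k] W) (π.rTensor W) where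
  subsingleton i hi := by
    have := h.subsingleton i hi
    exact inferInstanceAs (Subsingleton (M.cx.X i ⊗[k] W))
  exact a b c hab hbc hb x hx := by
    have ex : Function.Exact (M.cx.d c b).hom (M.cx.d b a).hom := fun y =>
      ⟨h.exact a b c hab hbc hb y, by
        rintro ⟨z, rfl⟩
        exact M.d_d_apply _ _ _ _⟩
    exact (Module.Flat.rTensor_exact W ex x).1 hx
  surjective := LinearMap.rTensor_surjective W h.surjective
  map_eq_zero_iff x := by
    have ex : Function.Exact (M.cx.d 1 0).hom π := h.map_eq_zero_iff
    exact rTensor_exact W ex h.surjective x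

theorem Resolves.ofNat {X : ℕ → ModuleCat.{u} k} {b : ∀ n, X (n + 1) ⟶ X n}
    {B : ∀ n, X n ⟶ X (n + 1)} {hb hB h0 hbB}
    (π : X 0 →ₗ[k] V) (exact : ∀ n x, (b n).hom x = 0 → ∃ y, (b (n + 1)).hom y = x)
    (surjective : Function.Surjective π)
    (map_eq_zero_iff : ∀ x, π x = 0 ↔ ∃ y, (b 0).hom y = x) :
    (MixedComplex.ofNat X b B hb hB h0 hbB).Resolves V π where
  subsingleton i hi := by
    match i with
    | Int.ofNat n => exact absurd hi (by simp)
    | Int.negSucc n => exact inferInstanceAs (Subsingleton PUnit)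
  exact i j l hij hjl hj x hx := by
    subst hij hjl
    match i with
    | Int.ofNat n =>
      have hd (m : ℕ) : (MixedComplex.ofNat X b B hb hB h0 hbB).cx.d (Int.ofNat m + 1)
          (Int.ofNat m) = b m := ChainComplex.of_d (extX X) (extb X b) _
      obtain ⟨y, hy⟩ := exact n x ((congrArg (fun f => f.hom x) (hd n)).symm.trans hx)
      exact ⟨y, (congrArg (fun f => f.hom y) (hd (n + 1))).trans hy⟩
    | Int.negSucc n => omega
  surjective := surjective
  map_eq_zero_iff x := by
    have : (MixedComplex.ofNat X b B hb hB h0 hbB).cx.d 1 0 = b 0 :=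
      ChainComplex.of_d (extX X) (extb X b) 0
    rw [this]
    exact map_eq_zero_iff x

variable (k) in
/-- The vector space `V` as a mixed complex in degree `0`. -/
noncomputable def inDegreeZero (V : ModuleCat.{u} k) : MixedComplex k where
  cx := (HomologicalComplex.single _ _ 0).obj V
  B _ _ := 0
  B_shape _ _ _ := rfl
  B_comp_B _ _ _ := Limits.comp_zero
  anticomm _ := by simp

theorem Resolves.d_comp (h : M.Resolves V π) (i : ℤ) (hi : (ComplexShape.down ℤ).Rel i 0) :
    M.cx.d i 0 ≫ ModuleCat.ofHom π = 0 := by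
  obtain rfl : 0 + 1 = i := hi
  ext y
  exact (h.map_eq_zero_iff _).2 ⟨y, rfl⟩

/-- The augmentation `M → V` as a morphism of mixed complexes. It commutes with `B` since `V` is
concentrated in degree `0`, where nothing is hit by `B`. -/
noncomputable def Resolves.augmentation (h : M.Resolves V π) :
    M ⟶ inDegreeZero k (ModuleCat.of k V) where
  hom := HomologicalComplex.mkHomToSingle (ModuleCat.ofHom π) h.d_comp
  comm i j := by
    refine Limits.comp_zero.trans ?_
    by_cases hij : i + 1 = j
    · by_cases hj : j = 0
      · have := h.subsingleton i (by omega)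
        exact (ModuleCat.isZero_of_subsingleton (M.cx.X i)).eq_of_src _ _
      · exact (HomologicalComplex.isZero_single_obj_X _ 0 (ModuleCat.of k V) j hj).eq_of_tgt _ _
    · rw [M.B_shape i j hij, Limits.zero_comp]

theorem Resolves.quasiIso_augmentation (h : M.Resolves V π) :
    MixedComplex.quasiIso k h.augmentation := by
  change QuasiIso h.augmentation.hom
  rw [quasiIso_iff]
  intro i
  rw [quasiIsoAt_iff_isIso_homologyMap]
  by_cases hi : i = 0
  · subst hi
    have hf : h.augmentation.hom.f 0 =
        ModuleCat.ofHom π ≫ (HomologicalComplex.singleObjXSelf _ 0 (ModuleCat.of k V)).inv :=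
      HomologicalComplex.mkHomToSingle_f _ h.d_comp
    have hprev : (ComplexShape.down ℤ).prev 0 = 1 := ComplexShape.prev_eq' _ rfl
    have hnext : (ComplexShape.down ℤ).next 0 = -1 :=
      ComplexShape.next_eq' _ (neg_add_cancel (1 : ℤ))
    have : Mono (HomologicalComplex.homologyMap h.augmentation.hom 0) := by
      rw [HomologicalComplex.mono_homologyMap_iff_up_to_refinements _ 1 0 (-1) hprev hnext]
      intro T x _ y hy
      have hS : (ShortComplex.mk (M.cx.d 1 0) (ModuleCat.ofHom π) (h.d_comp 1 rfl)).Exact := by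
        rw [ShortComplex.moduleCat_exact_iff]
        exact fun x hx => (h.map_eq_zero_iff x).1 hx
      refine hS.exact_up_to_refinements x ?_
      have hd : (inDegreeZero k (ModuleCat.of k V)).cx.d 1 0 = 0 :=
        HomologicalComplex.single_obj_d _ _ _ _ _
      rw [← cancel_mono
          (HomologicalComplex.singleObjXSelf (ComplexShape.down ℤ) 0 (ModuleCat.of k V)).inv,
        Category.assoc, Limits.zero_comp]
      rw [hf, hd, Limits.comp_zero] at hy
      exact hy
    have : Epi (HomologicalComplex.homologyMap h.augmentation.hom 0) := by
      rw [HomologicalComplex.epi_homologyMap_iff_up_to_refinements _ 1 0 (-1) hprev hnext]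
      intro T y _
      have hepi : Epi (h.augmentation.hom.f 0) := by
        have : Epi (ModuleCat.ofHom π) := (ModuleCat.epi_iff_surjective _).2 h.surjective
        have h' : Epi (HomologicalComplex.singleObjXSelf (ComplexShape.down ℤ) 0
            (ModuleCat.of k V)).inv := inferInstance
        rw [hf]
        exact epi_comp' this h'
      obtain ⟨T', p, hp, x, hx⟩ := surjective_up_to_refinements_of_epi (h.augmentation.hom.f 0) y
      refine ⟨T', p, hp, x, ?_, 0, by rw [hx, Limits.zero_comp, add_zero]⟩
      have := h.subsingleton (-1) (by omega)
      exact (ModuleCat.isZero_of_subsingleton (M.cx.X (-1))).eq_of_tgt _ _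
    exact isIso_of_mono_of_epi _
  · exact ((h.cx i).2 hi).isIso (HomologicalComplex.exactAt_single_obj _ _ _ _ hi).isZero_homology _

theorem Resolves.nonempty_toDMixed_iso (h : M.Resolves V π) {N : MixedComplex k}
    {ρ : N.cx.X 0 →ₗ[k] V} (h' : N.Resolves V ρ) :
    Nonempty ((toDMixed k).obj M ≅ (toDMixed k).obj N) := by
  have := Localization.inverts (toDMixed k) (MixedComplex.quasiIso k) _ h.quasiIso_augmentation
  have := Localization.inverts (toDMixed k) (MixedComplex.quasiIso k) _ h'.quasiIso_augmentation
  exact ⟨asIso ((toDMixed k).map h.augmentation) ≪≫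
    (asIso ((toDMixed k).map h'.augmentation)).symm⟩

end MixedComplex

/-! ### The Hochschild complex as a resolution of `A/[A,A]` -/

section

variable (k A : Type u) [Field k] [Ring A] [Algebra k A]

/-- The projection `A → A/[A,A]` on the degree `0` part of the Hochschild complex. -/
noncomputable def commutatorProjection : TPow k A 0 →ₗ[k] commutatorQuotient k A :=
  Submodule.mkQ _ ∘ₗ (PiTensorProduct.subsingletonEquiv (R := k) (s := fun _ => A)
    (0 : Fin 1)).toLinearMap

theorem subsingletonEquiv_hochschildB (a : Fin 2 → A) :
    PiTensorProduct.subsingletonEquiv (0 : Fin 1) (hochschildB k A 0 (PiTensorProduct.tprod k a)) =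
      a 0 * a 1 - a 1 * a 0 := by
  have h0 : face k A (0 : Fin 2) (PiTensorProduct.tprod k a) =
      PiTensorProduct.tprod k fun _ => a 0 * a 1 := by
    rw [← Fin.castSucc_zero, face_castSucc, contract_tprod]
    refine congrArg _ (funext fun l => ?_)
    obtain rfl : l = 0 := Subsingleton.elim (α := Fin 1) l 0
    simp [Fin.contractNth]
  have h1 : face k A (1 : Fin 2) (PiTensorProduct.tprod k a) =
      PiTensorProduct.tprod k fun _ => a 1 * a 0 := by
    refine (face_last_tprod k a).trans (congrArg _ (funext fun l => ?_))
    obtain rfl : l = 0 := Subsingleton.elim (α := Fin 1) l 0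
    rfl
  have : hochschildB k A 0 = face k A (0 : Fin 2) - face k A (1 : Fin 2) := by
    simp only [hochschildB, Fin.sum_univ_succ, Fin.sum_univ_zero, Fin.val_zero, Fin.val_succ,
      pow_zero, one_smul, zero_add, pow_one, add_zero, sub_eq_add_neg]
    exact congrArg (face k A (0 : Fin 2) + ·) (neg_one_smul k (face k A (1 : Fin 2)))
  rw [this, LinearMap.sub_apply, h0, h1, map_sub, PiTensorProduct.subsingletonEquiv_apply_tprod,
    PiTensorProduct.subsingletonEquiv_apply_tprod]

theorem commutatorProjection_eq_zero_iff (x : TPow k A 0) :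
    commutatorProjection k A x = 0 ↔ ∃ y, hochschildB k A 0 y = x := by
  let σ := PiTensorProduct.subsingletonEquiv (R := k) (s := fun _ => A) (0 : Fin 1)
  have key : Submodule.span k (Set.range fun p : A × A => p.1 * p.2 - p.2 * p.1) =
      LinearMap.range (σ.toLinearMap ∘ₗ hochschildB k A 0) := by
    apply le_antisymm
    · rw [Submodule.span_le]
      rintro _ ⟨p, rfl⟩
      exact ⟨PiTensorProduct.tprod k ![p.1, p.2], subsingletonEquiv_hochschildB k A _⟩
    · rw [LinearMap.range_eq_map, ← PiTensorProduct.span_tprod_eq_top, Submodule.map_span_le]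
      rintro _ ⟨a, rfl⟩
      refine Submodule.subset_span ⟨(a 0, a 1), (subsingletonEquiv_hochschildB k A a).symm⟩
  refine (Submodule.Quotient.mk_eq_zero _).trans ?_
  rw [key]
  constructor
  · rintro ⟨y, hy⟩
    exact ⟨y, σ.injective hy⟩
  · rintro ⟨y, rfl⟩
    exact ⟨y, rfl⟩

variable {k A} in
theorem IsSeparabilityIdempotent.resolves {e : A ⊗[k] A} (he : IsSeparabilityIdempotent k A e) :
    (C k A).Resolves (commutatorQuotient k A) (commutatorProjection k A) :=
  MixedComplex.Resolves.ofNat (X := fun n => ModuleCat.of k (TPow k A n))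
    (b := fun n => ModuleCat.ofHom (hochschildB k A n)) (commutatorProjection k A)
    (fun _ x hx => he.exists_hochschildB_eq x hx)
    ((Submodule.mkQ_surjective _).comp (LinearEquiv.surjective _))
    (commutatorProjection_eq_zero_iff k A)

/-- The algebra `k` is separable over itself, and `k/[k,k] = k`. -/
theorem exists_resolves_self : ∃ π : (C k k).cx.X 0 →ₗ[k] k, (C k k).Resolves k π := by
  have h : Submodule.span k (Set.range fun p : k × k => p.1 * p.2 - p.2 * p.1) = ⊥ := by
    rw [Submodule.span_eq_bot]
    rintro _ ⟨p, rfl⟩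
    exact sub_eq_zero.2 (mul_comm _ _)
  exact ⟨_, (isSeparabilityIdempotent_one k).resolves.postcomp (Submodule.quotEquivOfEqBot _ h)⟩

end

end CyclicHomology

theorem theorem7p1 (k A : Type u) [Field k] [Ring A] [Algebra k A]
    (hA : CyclicHomology.IsSeparableAlgebra k A) :
    -- the isomorphisms in the derived categories
    (Nonempty ((CyclicHomology.toDMixed k).obj (CyclicHomology.C k A) ≅
        (CyclicHomology.toDMixed k).obj
          ((CyclicHomology.C k k).tensor (CyclicHomology.HH0 k A))) ∧
      Nonempty ((CyclicHomology.toD k _).obj (CyclicHomology.HH k A) ≅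
        (CyclicHomology.toD k _).obj
          (CyclicHomology.tensorComplex (CyclicHomology.HH k k) (CyclicHomology.HH0 k A))) ∧
      Nonempty ((CyclicHomology.toD k _).obj (CyclicHomology.HC k A) ≅
        (CyclicHomology.toD k _).obj
          (CyclicHomology.tensorComplex (CyclicHomology.HC k k) (CyclicHomology.HH0 k A))) ∧
      Nonempty ((CyclicHomology.toD k _).obj (CyclicHomology.HP k A) ≅
        (CyclicHomology.toD k _).obj
          (CyclicHomology.tensorComplex (CyclicHomology.HP k k) (CyclicHomology.HH0 k A))) ∧
      Nonempty ((CyclicHomology.toD k _).obj (CyclicHomology.HN k A) ≅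
        (CyclicHomology.toD k _).obj
          (CyclicHomology.tensorComplex (CyclicHomology.HN k k) (CyclicHomology.HH0 k A)))) ∧
    -- the homology groups
    (∀ j : ℤ,
      (j = 0 → Nonempty ((CyclicHomology.HH k A).homology j ≅
        CyclicHomology.commutatorQuotient k A)) ∧
      (j ≠ 0 → Limits.IsZero ((CyclicHomology.HH k A).homology j)) ∧
      (0 ≤ j ∧ Even j → Nonempty ((CyclicHomology.HC k A).homology j ≅
        CyclicHomology.commutatorQuotient k A)) ∧
      (¬ (0 ≤ j ∧ Even j) → Limits.IsZero ((CyclicHomology.HC k A).homology j)) ∧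
      (Even j → Nonempty ((CyclicHomology.HP k A).homology (j : ZMod 2) ≅
        CyclicHomology.commutatorQuotient k A)) ∧
      (¬ Even j → Limits.IsZero ((CyclicHomology.HP k A).homology (j : ZMod 2))) ∧
      (j ≤ 0 ∧ Even j → Nonempty ((CyclicHomology.HN k A).homology j ≅
        CyclicHomology.commutatorQuotient k A)) ∧
      (¬ (j ≤ 0 ∧ Even j) → Limits.IsZero ((CyclicHomology.HN k A).homology j))) := by
  obtain ⟨e, he⟩ := hA.exists_idempotent
  have hC := he.resolves
  obtain ⟨π, hk⟩ := CyclicHomology.exists_resolves_self k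
  obtain ⟨ε⟩ := (hC.cx 0).1 rfl
  -- `ε` identifies `HH₀(A)`, the homology of the Hochschild complex in degree `0`, with `A/[A,A]`
  have hC' := hC.postcomp ε.toLinearEquiv.symm
  refine ⟨⟨?_, ?_, ?_, ?_, ?_⟩, fun j => ?_⟩
  · exact hC'.nonempty_toDMixed_iso ((hk.tensor _).postcomp (TensorProduct.lid k _))
  · exact CyclicHomology.nonempty_toD_iso_tensor _ _ _ (fun j => j = 0)
      (fun j => (hC'.cx j).1) (fun j => (hC'.cx j).2) (fun j => (hk.cx j).1) (fun j => (hk.cx j).2)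
  · exact CyclicHomology.nonempty_toD_iso_tensor _ _ _ (fun j => 0 ≤ j ∧ Even j)
      (fun j => (hC'.cyclic j).1) (fun j => (hC'.cyclic j).2)
      (fun j => (hk.cyclic j).1) (fun j => (hk.cyclic j).2)
  · exact CyclicHomology.nonempty_toD_iso_tensor _ _ _ (fun p => p = 0)
      (fun p => (hC'.periodic p).1) (fun p => (hC'.periodic p).2)
      (fun p => (hk.periodic p).1) (fun p => (hk.periodic p).2)
  · exact CyclicHomology.nonempty_toD_iso_tensor _ _ _ (fun j => j ≤ 0 ∧ Even j)
      (fun j => (hC'.negative j).1) (fun j => (hC'.negative j).2)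
      (fun j => (hk.negative j).1) (fun j => (hk.negative j).2)
  · have hj : (j : ZMod 2) = 0 ↔ Even j := ZMod.intCast_eq_zero_iff_even
    exact ⟨(hC.cx j).1, (hC.cx j).2, (hC.cyclic j).1, (hC.cyclic j).2,
      fun h => (hC.periodic j).1 (hj.2 h), fun h => (hC.periodic j).2 (mt hj.1 h),
      (hC.negative j).1, (hC.negative j).2⟩
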